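/- \textbf{Conventions.} A von Neumann algebra is a $C^*$-algebra that is $*$-isomorphic to a $*$-subalgebra $S$ of the bounded operators on some Hilbert space with $S=S''$. A positive linear map between von Neumann algebras is normal if it preserves suprema of bounded directed sets of self-adjoint elements. An NCP-map is a normal completely positive linear map; an NMIU-map is a normal unital $*$-homomorphism. For a von Neumann algebra $\mathscr B$, a pre-Hilbert $\mathscr B$-module is a right $\mathscr B$-module $X$ with a positive definite $\mathscr B$-valued inner product $\langle\cdot,\cdot\rangle$ that is antilinear in the first and $\mathscr B$-linear in the second variable ($\langle x,yb\rangle=\langle x,y\rangle b$), with $\langle x,y\rangle^*=\langle y,x\rangle$, normed by $\|x\|=\|\langle x,x\rangle\|^{1/2}$. It is a Hilbert $\mathscr B$-module if it is complete, and a Hilbert $\mathscr B$-module $X$ is self-dual if every bounded module map $X\to\mathscr B$ is of the form $\langle x,\cdot\rangle$ with $x\in X$. $B^a(X)$ denotes the $C^*$-algebra of adjointable operators on a Hilbert $\mathscr B$-module $X$ (for self-dual $X$ these are all the bounded module maps $X\to X$). A Paschke dilation of an NCP-map $\varphi\colon\mathscr A\to\mathscr B$ is a pair $\mathscr A\xrightarrow{\varrho}\mathscr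 P\xrightarrow{f}\mathscr B$, where $\mathscr P$ is a von Neumann algebra, $\varrho$ an NMIU-map and $f$ an NCP-map with $\varphi=f\circ\varrho$, such that for every von Neumann algebra $\mathscr P'$, NMIU-map $\varrho'\colon\mathscr A\to\mathscr P'$ and NCP-map $f'\colon\mathscr P'\to\mathscr B$ with $\varphi=f'\circ\varrho'$ there is a unique NCP-map $\sigma\colon\mathscr P'\to\mathscr P$ with $\sigma\circ\varrho'=\varrho$ and $f\circ\sigma=f'$. A complex bilinear map $\beta\colon\mathscr A\times\mathscr B\to Y$ into a self-dual Hilbert $\mathscr B$-module $Y$ is $\varphi$-compatible if $\beta(a,b_1)b_2=\beta(a,b_1b_2)$ for all $a\in\mathscr A$, $b_1,b_2\in\mathscr B$, and there is $r>0$ such that for all $n$, $a_1,\dots,a_n\in\mathscr A$ and $b_1,\dots,b_n\in\mathscr B$ $$\Bigl\|\sum_i \beta(a_i,b_i)\Bigr\|^2\le r\,\Bigl\|\sum_{i,j}b_i^*\varphi(a_i^*a_j)b_j\Bigr\|.$$ \textbf{Theorem.} Let $\varphi\colon\mathscr A\to\mathscr B$ be an NCP-map between von Neumann algebras. There are a self-dual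 Hilbert $\mathscr B$-module $\mathscr A\otimes_\varphi\mathscr B$ and a $\varphi$-compatible bilinear map $\otimes\colon\mathscr A\times\mathscr B\to\mathscr A\otimes_\varphi\mathscr B$ with $$\langle a\otimes b,\alpha\otimes\beta\rangle=b^*\varphi(a^*\alpha)\beta\qquad(a,\alpha\in\mathscr A,\ b,\beta\in\mathscr B),$$ such that $\mathscr A\otimes_\varphi\mathscr B$ is the self-dual completion of the $\mathscr B$-submodule $X_0$ spanned by the elements $a\otimes b$ (every bounded module map $\tau\colon X_0\to\mathscr B$ equals $\langle x,\cdot\rangle|_{X_0}$ for a unique $x\in\mathscr A\otimes_\varphi\mathscr B$), and such that the following hold. \begin{enumerate} \item For every self-dual Hilbert $\mathscr B$-module $Y$ and every $\varphi$-compatible bilinear map $\beta\colon\mathscr A\times\mathscr B\to Y$ there is a unique bounded module map $T\colon\mathscr A\otimes_\varphi\mathscr B\to Y$ with $T(a\otimes b)=\beta(a,b)$ for all $a\in\mathscr A$, $b\in\mathscr B$. \item For every $a_0\in\mathscr A$ there is a unique bounded module map $\varrho(a_0)$ on $\mathscr A\otimes_\varphi\mathscr B$ with $\varrho(a_0)(a\otimes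 b)=(a_0a)\otimes b$ for all $a,b$, and $a_0\mapsto\varrho(a_0)$ is an NMIU-map $\varrho\colon\mathscr A\to B^a(\mathscr A\otimes_\varphi\mathscr B)$. \item $f(T)=\langle 1\otimes1,T(1\otimes1)\rangle$ defines an NCP-map $f\colon B^a(\mathscr A\otimes_\varphi\mathscr B)\to\mathscr B$. \item $B^a(\mathscr A\otimes_\varphi\mathscr B)$ is a von Neumann algebra and $\mathscr A\xrightarrow{\varrho}B^a(\mathscr A\otimes_\varphi\mathscr B)\xrightarrow{f}\mathscr B$ is a Paschke dilation of $\varphi$. \end{enumerate} In particular, every NCP-map between von Neumann algebras has a Paschke dilation. -/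

import Mathlib

open MulOpposite
open scoped CStarAlgebra

universe u v w x y

/-! ### Von Neumann algebras and normal maps -/

/-- A C⋆-algebra is a von Neumann algebra if it is ⋆-isomorphic to a concrete one, i.e. to a
⋆-subalgebra of the bounded operators on some Hilbert space that equals its double commutant. -/
def IsVonNeumannAlgebra (A : Type u) [CStarAlgebra A] : Prop :=
  ∃ (H : Type u) (_ : NormedAddCommGroup H) (_ : InnerProductSpace ℂ H) (_ : CompleteSpace H)
    (S : VonNeumannAlgebra H), Nonempty (A ≃⋆ₐ[ℂ] S.toStarSubalgebra)

/-- A map is normal if it preserves the suprema of (nonempty, upward) directed sets of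
self-adjoint elements, whenever these suprema exist.  (In a von Neumann algebra they exist as
soon as the set is bounded above.) -/
def IsNormalMap {A : Type u} {B : Type v} [Star A] [PartialOrder A] [PartialOrder B]
    (φ : A → B) : Prop :=
  ∀ D : Set A, (∀ d ∈ D, IsSelfAdjoint d) → D.Nonempty → DirectedOn (· ≤ ·) D →
    ∀ s : A, IsLUB D s → IsLUB (φ '' D) (φ s)

/-! ### Right Hilbert modules -/

/-- A right pre-Hilbert module over a C⋆-algebra `B`.  The right action of `b` on `z` is
`op b • z`, the `B`-valued inner product is antilinear in the first and linear in the second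
variable, and the norm of the module is the one that the inner product defines.
The module is a Hilbert module if it is moreover a `CompleteSpace`. -/
class PreHilbertModule (B : Type v) (X : Type x) [CStarAlgebra B] [PartialOrder B]
    [NormedAddCommGroup X] [NormedSpace ℂ X] [Module Bᵐᵒᵖ X] [IsScalarTower ℂ Bᵐᵒᵖ X]
    extends Inner B X where
  inner_add_right (z z₁ z₂ : X) : inner z (z₁ + z₂) = inner z z₁ + inner z z₂
  inner_op_smul_right (z z' : X) (b : B) : inner z (op b • z') = inner z z' * b
  inner_self_nonneg (z : X) : 0 ≤ inner z z
  inner_self_eq_zero (z : X) : inner z z = 0 ↔ z = 0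
  star_inner (z z' : X) : star (inner z z') = inner z' z
  norm_eq_sqrt (z : X) : ‖z‖ = Real.sqrt ‖inner z z‖

/-- Self-duality: every bounded module map `X → B` is of the form `⟨z, · ⟩`. -/
def IsSelfDual (B : Type v) (X : Type x) [CStarAlgebra B] [PartialOrder B]
    [NormedAddCommGroup X] [NormedSpace ℂ X] [Module Bᵐᵒᵖ X] [IsScalarTower ℂ Bᵐᵒᵖ X]
    [PreHilbertModule B X] : Prop :=
  ∀ τ : X →L[Bᵐᵒᵖ] B, ∃ z : X, ∀ z' : X, τ z' = inner B z z'

namespace PreHilbertModule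

variable {B : Type v} {X : Type x} [CStarAlgebra B] [PartialOrder B]
  [NormedAddCommGroup X] [NormedSpace ℂ X] [Module Bᵐᵒᵖ X] [IsScalarTower ℂ Bᵐᵒᵖ X]
  [PreHilbertModule B X]

theorem inner_add_left (z z' t : X) : inner B (z + z') t = inner B z t + inner B z' t := by
  rw [← star_inner t, inner_add_right, star_add, star_inner, star_inner]

theorem inner_op_smul_left (z z' : X) (b : B) :
    inner B (op b • z) z' = star b * inner B z z' := by
  rw [← star_inner z', inner_op_smul_right, star_mul, star_inner]

theorem inner_smul_right (c : ℂ) (z z' : X) : inner B z (c • z') = c • inner B z z' := by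
  have h : c • z' = op (c • (1 : B)) • z' := by rw [op_smul, op_one, smul_assoc, one_smul]
  rw [h, inner_op_smul_right, mul_smul_comm, mul_one]

theorem inner_smul_left (c : ℂ) (z z' : X) :
    inner B (c • z) z' = star c • inner B z z' := by
  rw [← star_inner z', inner_smul_right, star_smul, star_inner]

theorem inner_neg_right (z z' : X) : inner B z (-z') = -inner B z z' := by
  have := inner_smul_right (B := B) (-1) z z'
  simpa using this

theorem inner_sub_right (z t t' : X) : inner B z (t - t') = inner B z t - inner B z t' := by
  rw [sub_eq_add_neg, inner_add_right, inner_neg_right, ← sub_eq_add_neg]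

theorem inner_sub_left (z z' t : X) : inner B (z - z') t = inner B z t - inner B z' t := by
  rw [← star_inner t, inner_sub_right, star_sub, star_inner, star_inner]

theorem norm_sq (z : X) : ‖z‖ ^ 2 = ‖inner B z z‖ := by
  rw [norm_eq_sqrt (B := B), Real.sq_sqrt (norm_nonneg _)]

theorem eq_of_inner_left {z z' : X} (h : ∀ t : X, inner B z t = inner B z' t) : z = z' := by
  rw [← sub_eq_zero, ← inner_self_eq_zero (B := B), inner_sub_left, h, sub_self]

/-- The Cauchy-Schwarz inequality. -/
theorem norm_inner_le [StarOrderedRing B] (z t : X) : ‖inner B z t‖ ≤ ‖z‖ * ‖t‖ := by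
  rcases eq_or_ne z 0 with rfl | hz
  · have : inner B (0 : X) t = 0 := by
      have := inner_sub_left (B := B) (0 : X) 0 t
      simpa using this
    simp [this]
  have hpos : 0 < ‖z‖ ^ 2 := by positivity
  set a : B := inner B z t with ha
  set r : ℝ := ‖z‖ ^ 2 with hr
  have hconj : star a * inner B z z * a ≤ r • (star a * a) := by
    rw [hr, norm_sq (B := B)]
    exact CStarAlgebra.star_left_conjugate_le_norm_smul (isSelfAdjoint_iff.2 (star_inner z z))
  have hta : inner B t z = star a := by rw [ha, star_inner]
  have h0 : 0 ≤ star a * inner B z z * a - r • (star a * a) - r • (star a * a)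
      + r • (r • inner B t t) := by
    have h1 := inner_self_nonneg (B := B) (op a • z - (r : ℂ) • t)
    have h2 : inner B (op a • z - (r : ℂ) • t) (op a • z - (r : ℂ) • t)
        = star a * inner B z z * a - r • (star a * a) - r • (star a * a)
          + r • (r • inner B t t) := by
      rw [inner_sub_left, inner_sub_right, inner_sub_right, inner_op_smul_left,
        inner_op_smul_right, inner_op_smul_left, inner_smul_right, inner_smul_left,
        inner_smul_left, inner_smul_right, inner_op_smul_right, hta, ← ha]
      simp only [RCLike.star_def, Complex.conj_ofReal, Complex.coe_smul, mul_smul_comm,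
        mul_assoc]
      abel
    rwa [h2] at h1
  have h3 : r • (star a * a) ≤ r • (r • inner B t t) := by
    have h4 := h0.trans (add_le_add_left (sub_le_sub_right (sub_le_sub_right hconj _) _) _)
    have h5 : r • (star a * a) - r • (star a * a) - r • (star a * a) + r • (r • inner B t t)
        = r • (r • inner B t t) - r • (star a * a) := by abel
    rw [h5] at h4
    exact sub_nonneg.1 h4
  have h6 : star a * a ≤ r • inner B t t := (smul_le_smul_iff_of_pos_left hpos).1 h3
  have h7 : ‖a‖ ^ 2 ≤ (‖z‖ * ‖t‖) ^ 2 := by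
    calc ‖a‖ ^ 2 = ‖star a * a‖ := by rw [CStarRing.norm_star_mul_self, pow_two]
      _ ≤ ‖r • inner B t t‖ :=
        CStarAlgebra.norm_le_norm_of_nonneg_of_le (star_mul_self_nonneg a) h6
      _ = (‖z‖ * ‖t‖) ^ 2 := by
        rw [norm_smul, ← norm_sq (B := B), Real.norm_of_nonneg hpos.le, hr, mul_pow]
  exact (pow_le_pow_iff_left₀ (norm_nonneg _) (by positivity) two_ne_zero).1 h7

end PreHilbertModule

/-! ### The C⋆-algebra `B^a(X)` of adjointable operators -/

section Adjointable

variable (B : Type v) (X : Type x) [CStarAlgebra B] [PartialOrder B]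
  [NormedAddCommGroup X] [NormedSpace ℂ X] [Module Bᵐᵒᵖ X] [IsScalarTower ℂ Bᵐᵒᵖ X]
  [PreHilbertModule B X]

/-- The algebra of bounded operators on `X` that have an adjoint. -/
def adjointableSubalgebra : Subalgebra ℂ (X →L[ℂ] X) where
  carrier := {T | ∃ S : X →L[ℂ] X, ∀ z z' : X, inner B (T z) z' = inner B z (S z')}
  mul_mem' := by
    rintro T T' ⟨S, hS⟩ ⟨S', hS'⟩
    exact ⟨S' * S, fun z z' => by simp [hS, hS']⟩
  add_mem' := by
    rintro T T' ⟨S, hS⟩ ⟨S', hS'⟩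
    exact ⟨S + S', fun z z' => by simp [hS, hS', PreHilbertModule.inner_add_left, PreHilbertModule.inner_add_right]⟩
  algebraMap_mem' c := ⟨algebraMap ℂ _ (star c), fun z z' => by
    simp [Algebra.algebraMap_eq_smul_one, PreHilbertModule.inner_smul_left, PreHilbertModule.inner_smul_right]⟩

/-- The algebra `B^a(X)` of adjointable operators on a Hilbert `B`-module `X`.  Adjointable
operators are module maps (see `AdjointableOperator.map_op_smul`); if `X` is self-dual, they are
all the bounded module maps on `X`. -/
def AdjointableOperator : Type x := ↥(adjointableSubalgebra B X)

namespace AdjointableOperator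

noncomputable instance : NormedRing (AdjointableOperator B X) :=
  inferInstanceAs (NormedRing ↥(adjointableSubalgebra B X))

noncomputable instance : NormedAlgebra ℂ (AdjointableOperator B X) :=
  inferInstanceAs (NormedAlgebra ℂ ↥(adjointableSubalgebra B X))

variable {B X}

/-- The underlying bounded operator. -/
def toCLM (T : AdjointableOperator B X) : X →L[ℂ] X := Subtype.val T

instance : CoeFun (AdjointableOperator B X) (fun _ => X → X) := ⟨fun T => T.toCLM⟩

theorem toCLM_injective : Function.Injective (toCLM : AdjointableOperator B X → X →L[ℂ] X) :=
  Subtype.val_injective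

/-- The adjoint, as a bounded operator. -/
noncomputable def adj (T : AdjointableOperator B X) : X →L[ℂ] X := Classical.choose T.2

theorem inner_adj_right (T : AdjointableOperator B X) (z z' : X) :
    inner B (T z) z' = inner B z (T.adj z') := Classical.choose_spec T.2 z z'

theorem inner_adj_left (T : AdjointableOperator B X) (z z' : X) :
    inner B (T.adj z) z' = inner B z (T z') := by
  rw [← PreHilbertModule.star_inner z', ← inner_adj_right, PreHilbertModule.star_inner]

theorem map_op_smul (T : AdjointableOperator B X) (b : B) (z : X) :
    T (op b • z) = op b • T z :=
  PreHilbertModule.eq_of_inner_left (B := B) fun t => by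
    rw [inner_adj_right, PreHilbertModule.inner_op_smul_left, PreHilbertModule.inner_op_smul_left, inner_adj_right]

theorem adj_eq_of (T : AdjointableOperator B X) (S : X →L[ℂ] X)
    (h : ∀ z z' : X, inner B (S z) z' = inner B z (T z')) : T.adj = S := by
  ext z
  exact PreHilbertModule.eq_of_inner_left (B := B) fun t => by rw [inner_adj_left, h]

/-- The involution of `B^a(X)` is the adjoint. -/
noncomputable instance : Star (AdjointableOperator B X) :=
  ⟨fun T => ⟨T.adj, T.toCLM, T.inner_adj_left⟩⟩

theorem toCLM_star (T : AdjointableOperator B X) : (star T).toCLM = T.adj := rfl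

noncomputable instance : StarRing (AdjointableOperator B X) where
  star_involutive T := toCLM_injective <| by
    rw [toCLM_star]
    exact adj_eq_of _ _ fun z z' => T.inner_adj_right z z'
  star_mul T T' := toCLM_injective <| by
    rw [toCLM_star]
    refine adj_eq_of _ _ fun z z' => ?_
    change inner B (T'.adj (T.adj z)) z' = inner B z (T (T' z'))
    rw [inner_adj_left, inner_adj_left]
  star_add T T' := toCLM_injective <| by
    rw [toCLM_star]
    refine adj_eq_of _ _ fun z z' => ?_
    change inner B (T.adj z + T'.adj z) z' = inner B z (T z' + T' z')
    rw [PreHilbertModule.inner_add_left, PreHilbertModule.inner_add_right, inner_adj_left, inner_adj_left]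

noncomputable instance : StarModule ℂ (AdjointableOperator B X) where
  star_smul c T := toCLM_injective <| by
    rw [toCLM_star]
    refine adj_eq_of _ _ fun z z' => ?_
    change inner B (star c • T.adj z) z' = inner B z (c • T z')
    rw [PreHilbertModule.inner_smul_left, PreHilbertModule.inner_smul_right, star_star, inner_adj_left]

variable [StarOrderedRing B]

instance : CStarRing (AdjointableOperator B X) where
  norm_mul_self_le T := by
    have key : ‖T.toCLM‖ ≤ Real.sqrt ‖star T * T‖ := by
      refine T.toCLM.opNorm_le_bound (Real.sqrt_nonneg _) fun z => ?_
      have h1 : ‖T z‖ ^ 2 ≤ ‖star T * T‖ * ‖z‖ ^ 2 := by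
        calc ‖T z‖ ^ 2 = ‖inner B z (T.adj (T z))‖ := by
              rw [PreHilbertModule.norm_sq (B := B), inner_adj_right]
          _ ≤ ‖z‖ * ‖T.adj (T z)‖ := PreHilbertModule.norm_inner_le _ _
          _ ≤ ‖z‖ * (‖star T * T‖ * ‖z‖) := by
              gcongr
              exact (star T * T).toCLM.le_opNorm z
          _ = ‖star T * T‖ * ‖z‖ ^ 2 := by ring
      rw [← Real.sqrt_sq (norm_nonneg z), ← Real.sqrt_mul (norm_nonneg _)]
      exact Real.le_sqrt_of_sq_le h1
    calc ‖T‖ * ‖T‖ = ‖T.toCLM‖ ^ 2 := by rw [pow_two]; rfl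
      _ ≤ (Real.sqrt ‖star T * T‖) ^ 2 := by gcongr
      _ = ‖star T * T‖ := Real.sq_sqrt (norm_nonneg _)

theorem continuous_inner_left (t : X) : Continuous fun z : X => inner B z t := by
  refine continuous_iff_continuousAt.2 fun z₀ => ?_
  refine tendsto_iff_norm_sub_tendsto_zero.2 ?_
  have h : Filter.Tendsto (fun z : X => ‖z - z₀‖ * ‖t‖) (nhds z₀) (nhds 0) := by
    have : Continuous fun z : X => ‖z - z₀‖ * ‖t‖ := by fun_prop
    simpa using this.tendsto z₀
  refine squeeze_zero (fun _ => norm_nonneg _) (fun z => ?_) h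
  rw [← PreHilbertModule.inner_sub_left]
  exact PreHilbertModule.norm_inner_le _ _

theorem continuous_inner_right (t : X) : Continuous fun z : X => inner B t z := by
  have : (fun z : X => inner B t z) = fun z => star (inner B z t) := by
    funext z; rw [PreHilbertModule.star_inner]
  rw [this]
  exact (continuous_inner_left t).star

instance [CompleteSpace X] : CompleteSpace (AdjointableOperator B X) := by
  let C : Set ((X →L[ℂ] X) × (X →L[ℂ] X)) :=
    {p | ∀ z z' : X, inner B (p.1 z) z' = inner B z (p.2 z')}
  have hC : IsClosed C := by
    simp only [C, Set.ofPred_forall]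
    refine isClosed_iInter fun z => isClosed_iInter fun z' => isClosed_eq ?_ ?_
    · exact (continuous_inner_left z').comp (by fun_prop)
    · exact (continuous_inner_right z).comp (by fun_prop)
  have hCc : CompleteSpace C := hC.completeSpace_coe
  let F : C → AdjointableOperator B X := fun p => ⟨p.1.1, p.1.2, p.2⟩
  have hF : Function.Surjective F := fun T =>
    ⟨⟨(T.toCLM, T.adj), T.inner_adj_right⟩, rfl⟩
  have hiso : Isometry F := by
    refine Isometry.of_dist_eq fun p q => ?_
    have hs : ∀ p : C, (star (F p)).toCLM = p.1.2 := fun p =>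
      adj_eq_of _ _ fun z z' => by
        rw [← PreHilbertModule.star_inner z', ← p.2, PreHilbertModule.star_inner]; rfl
    have h1 : dist p.1.1 q.1.1 = dist (F p) (F q) := rfl
    have h2 : dist p.1.2 q.1.2 = dist (F p) (F q) := by
      rw [← hs, ← hs]
      change dist (star (F p)) (star (F q)) = _
      rw [dist_eq_norm, ← star_sub, norm_star, dist_eq_norm]
    rw [Subtype.dist_eq, Prod.dist_eq, h1, h2, max_self]
  exact (completeSpace_congr (e := Equiv.ofBijective F ⟨hiso.injective, hF⟩)
    hiso.isUniformEmbedding).1 hCc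

noncomputable instance [CompleteSpace X] : CStarAlgebra (AdjointableOperator B X) where

/-- The order of `B^a(X)` is its order as a C⋆-algebra: the positive elements are the
self-adjoint elements with nonnegative spectrum, that is, the elements `star T * T`. -/
noncomputable instance [CompleteSpace X] : PartialOrder (AdjointableOperator B X) :=
  CStarAlgebra.spectralOrder _

instance [CompleteSpace X] : StarOrderedRing (AdjointableOperator B X) :=
  CStarAlgebra.spectralOrderedRing _

end AdjointableOperator

end Adjointable

/-! ### Compatible bilinear maps and Paschke dilations -/

/-- A complex bilinear map `β : A × B → Y` into a right `B`-module is `φ`-compatible if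
`β (a, b₁) b₂ = β (a, b₁ b₂)` and if there is an `r > 0` with
`‖∑ᵢ β (aᵢ, bᵢ)‖² ≤ r ‖∑ᵢⱼ bᵢ⋆ φ(aᵢ⋆ aⱼ) bⱼ‖` for all finite families. -/
def IsCompatible {A : Type u} {B : Type v} {Y : Type y} [CStarAlgebra A] [CStarAlgebra B]
    [NormedAddCommGroup Y] [NormedSpace ℂ Y] [Module Bᵐᵒᵖ Y]
    (φ : A → B) (β : A →ₗ[ℂ] B →ₗ[ℂ] Y) : Prop :=
  (∃ r : ℝ, 0 < r ∧ ∀ (n : ℕ) (a : Fin n → A) (b : Fin n → B),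
    ‖∑ i, β (a i) (b i)‖ ^ 2 ≤
      r * ‖∑ i, ∑ j, star (b i) * φ (star (a i) * a j) * b j‖) ∧
  ∀ (a : A) (b₁ b₂ : B), op b₂ • β a b₁ = β a (b₁ * b₂)

/-- `A --ρ--> P --f--> B` is a Paschke dilation of `φ : A → B`: `P` is a von Neumann algebra,
`ρ` is an NMIU-map (a normal unital ⋆-homomorphism), `f` is an NCP-map (normal and completely
positive) with `f ∘ ρ = φ`, and every other such factorisation `A --ρ'--> P' --f'--> B` of `φ`
has a unique mediating NCP-map `σ : P' → P`. -/
def IsPaschkeDilation {A : Type u} {B : Type v} {P : Type x}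
    [CStarAlgebra A] [PartialOrder A] [StarOrderedRing A]
    [CStarAlgebra B] [PartialOrder B] [StarOrderedRing B]
    [CStarAlgebra P] [PartialOrder P] [StarOrderedRing P]
    (φ : A →CP B) (ρ : A →⋆ₐ[ℂ] P) (f : P →CP B) : Prop :=
  IsVonNeumannAlgebra P ∧ IsNormalMap ρ ∧ IsNormalMap f ∧ (∀ a, f (ρ a) = φ a) ∧
  ∀ (P' : Type w) [CStarAlgebra P'] [PartialOrder P'] [StarOrderedRing P'],
    IsVonNeumannAlgebra P' →
    ∀ (ρ' : A →⋆ₐ[ℂ] P') (f' : P' →CP B), IsNormalMap ρ' → IsNormalMap f' →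
      (∀ a, f' (ρ' a) = φ a) →
      ∃! σ : P' →CP P, IsNormalMap σ ∧ (∀ a, σ (ρ' a) = ρ a) ∧ ∀ p, f (σ p) = f' p

/-! ### Positivity in C⋆-algebras and of matrices over them -/

section Positivity

variable {A : Type*} {B : Type*} [CStarAlgebra A] [PartialOrder A] [StarOrderedRing A]
  [CStarAlgebra B] [PartialOrder B] [StarOrderedRing B]

/-! Represent B faithfully on a Hilbert space K as a concrete von Neumann algebra l(B), and let H be
the Stinespring space of l ∘ φ: the completion of A ⊗ K for ⟨a ⊗ k, α ⊗ k'⟩ = ⟨k, l(φ(a⋆α))k'⟩, with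
ε a k = a ⊗ k (`exists_isStinespring`). On H, the algebra A acts by left multiplication and each c
in the commutant l(B)' acts as 1 ⊗ c. The module A ⊗_φ B is realised as the space X of all operators
z : K → H with z c = (1 ⊗ c) z for every c in l(B)'. For two such operators z⋆z' commutes with
l(B)', hence lies in l(B) by the double commutant property; this is the inner product. The element a
⊗ b is ε a ∘ l b.

Self-duality: a bounded B-valued module map on elements with total range in H induces a bounded
operator H → K, and its adjoint is again an intertwiner (`exists_inner_eq`). The analytic core is
`norm_sum_map_le`, which turns norm estimates in the module into positivity of a matrix over B and
then into estimates for vectors of H. The universal property follows by constructing the adjoint of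
the desired map first (`existsUnique_lift`); applied to (a, b) ↦ a₀a ⊗ b it yields left
multiplication. Adjointable operators on X extend to H, and B^a(X) becomes the commutant of all 1 ⊗
c (`lmul_bijective`), a von Neumann algebra.

For another factorisation φ = f' ∘ ρ', the map W : a ⊗ k ↦ ρ'(a) ⊗ k embeds H isometrically into the
Stinespring space of l ∘ f', on which P' acts by π'. The mediating map is σ(p) = W⋆π'(p)W: it
commutes with all 1 ⊗ c, and it is normal because π' is (`isWeaklyNormal_rep`). Conversely a
mediating map τ is unital and multiplicative on the range of ρ', so f(ρ(a)⋆τ(p)ρ(α)) =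
f'(ρ'(a)⋆pρ'(α)) is forced, and these values are the matrix coefficients of τ(p) on a total family.
Normality is handled as weak convergence in faithful representations. -/

theorem le_smul_of_forall_norm_conjugate_le {p q : B} (hp : 0 ≤ p) (hq : 0 ≤ q) {C : ℝ}
    (hC : 0 ≤ C) (h : ∀ b : B, ‖star b * p * b‖ ≤ C * ‖star b * q * b‖) : p ≤ C • q := by
  -- Test with b = (q + ε)^(-1/2): then b⋆qb ≤ 1, so b⋆pb ≤ C, and conjugating back by (q + ε)^(1/2)
  -- gives the bound. The shift by ε makes the inverse root available and is removed in the limit.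
  have key : ∀ ε : ℝ, 0 < ε → p ≤ C • (q + algebraMap ℝ B ε) := by
    intro ε hε
    have hs : IsStrictlyPositive (q + algebraMap ℝ B ε) :=
      IsStrictlyPositive.nonneg_add hq (by
        rw [Algebra.algebraMap_eq_smul_one]
        exact IsStrictlyPositive.smul hε isStrictlyPositive_one)
    set d : B := q + algebraMap ℝ B ε with hd
    have hqd : q ≤ d := by
      rw [hd]
      exact le_add_of_nonneg_right (algebraMap_nonneg B hε.le)
    set c : B := d ^ (-(1 / 2) : ℝ) with hc
    set e : B := d ^ ((1 / 2) : ℝ) with he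
    have hcs : star c = c := (IsSelfAdjoint.of_nonneg CFC.rpow_nonneg).star_eq
    have hes : star e = e := (IsSelfAdjoint.of_nonneg CFC.rpow_nonneg).star_eq
    have hcdc : c * d * c = 1 := CFC.conjugate_rpow_neg_one_half d
    have hce : c * e = 1 := by
      rw [hc, he, ← CFC.rpow_add hs.isUnit]
      norm_num
      exact CFC.rpow_zero d hs.nonneg
    have hec : e * c = 1 := by
      rw [hc, he, ← CFC.rpow_add hs.isUnit]
      norm_num
      exact CFC.rpow_zero d hs.nonneg
    have hee : e * e = d := by
      rw [he, ← CFC.rpow_add hs.isUnit]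
      norm_num
      exact CFC.rpow_one d hs.nonneg
    have hcqc : ‖star c * q * c‖ ≤ 1 := by
      rw [CStarAlgebra.norm_le_one_iff_of_nonneg _ (star_left_conjugate_nonneg hq c), ← hcdc]
      calc star c * q * c ≤ star c * d * c := star_left_conjugate_le_conjugate hqd c
        _ = c * d * c := by rw [hcs]
    have hcpc : ‖star c * p * c‖ ≤ C := (h c).trans (by nlinarith)
    have hcpc' : star c * p * c ≤ algebraMap ℝ B C :=
      (CStarAlgebra.norm_le_iff_le_algebraMap _ hC (star_left_conjugate_nonneg hp c)).1 hcpc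
    have := star_left_conjugate_le_conjugate hcpc' e
    calc p = (e * c) * p * (c * e) := by rw [hce, hec, one_mul, mul_one]
      _ = star e * (star c * p * c) * e := by rw [hes, hcs]; simp only [mul_assoc]
      _ ≤ star e * algebraMap ℝ B C * e := this
      _ = C • d := by
        rw [Algebra.algebraMap_eq_smul_one, mul_smul_comm, mul_one, smul_mul_assoc, hes, hee]
  have hlim : Filter.Tendsto (fun ε : ℝ => C • (q + algebraMap ℝ B ε)) (nhdsWithin 0 (Set.Ioi 0))
      (nhds (C • q)) := by
    have : Continuous fun ε : ℝ => C • (q + algebraMap ℝ B ε) := by fun_prop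
    simpa using (this.tendsto 0).mono_left nhdsWithin_le_nhds
  exact ge_of_tendsto hlim (eventually_nhdsWithin_of_forall fun ε hε => key ε hε)

/-- An injective ⋆-homomorphism of C⋆-algebras reflects positivity. -/
theorem StarAlgHom.nonneg_iff_of_injective (φ : A →⋆ₐ[ℂ] B) (hφ : Function.Injective φ) {a : A} :
    0 ≤ φ a ↔ 0 ≤ a := by
  refine ⟨fun h => ?_, fun h => map_nonneg φ h⟩
  have hsa : IsSelfAdjoint a := hφ (by rw [map_star, (IsSelfAdjoint.of_nonneg h).star_eq])
  rw [StarOrderedRing.nonneg_iff_spectrum_nonneg (R := ℝ) _ hsa]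
  rw [StarOrderedRing.nonneg_iff_spectrum_nonneg (R := ℝ) _ (hsa.map φ),
    hsa.map_spectrum_real φ hφ] at h
  exact h

theorem exists_star_mul_self_of_nonneg {a : A} (ha : 0 ≤ a) : ∃ c, a = star c * c :=
  CStarAlgebra.nonneg_iff_eq_star_mul_self.1 ha

/-- The negative part of a self-adjoint element of a C⋆-algebra. -/
theorem exists_conjugate_eq_neg_cube {a : A} (ha : IsSelfAdjoint a) :
    ∃ c : A, 0 ≤ c ∧ c * a * c = -(c * c * c) ∧ (c * c * c = 0 → 0 ≤ a) := by
  have hs : IsSelfAdjoint a⁻ := IsSelfAdjoint.of_nonneg (CFC.negPart_nonneg a)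
  refine ⟨a⁻, CFC.negPart_nonneg a, ?_, fun h => ?_⟩
  · have h1 : a⁻ * a * a⁻ = a⁻ * (a⁺ - a⁻) * a⁻ := by rw [CFC.posPart_sub_negPart a ha]
    rw [h1, mul_sub, sub_mul, CFC.negPart_mul_posPart, zero_mul, zero_sub]
  · rw [CStarAlgebra.nonneg_iff_isSelfAdjoint_and_negPart_eq_zero]
    refine ⟨ha, ?_⟩
    -- A vanishing cube kills the fourth power; the C⋆-identity, applied twice, then kills a⁻
    -- itself.
    have h2 : star (a⁻ * a⁻) * (a⁻ * a⁻) = 0 := by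
      rw [star_mul, hs.star_eq, ← mul_assoc, h, zero_mul]
    rw [CStarRing.star_mul_self_eq_zero_iff] at h2
    rw [← CStarRing.star_mul_self_eq_zero_iff, hs.star_eq, h2]

namespace CStarMatrix

variable {n : ℕ}

theorem exists_eq_sum_star_mul_of_nonneg {M : CStarMatrix (Fin n) (Fin n) B} (hM : 0 ≤ M) :
    ∃ R : Fin n → Fin n → B, ∀ i j, M i j = ∑ l, star (R l i) * R l j := by
  obtain ⟨R, rfl⟩ := exists_star_mul_self_of_nonneg hM
  refine ⟨fun l j => R l j, fun i j => ?_⟩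
  rw [CStarMatrix.mul_apply]
  simp only [CStarMatrix.star_apply]

theorem apply_self_nonneg {M : CStarMatrix (Fin n) (Fin n) B} (hM : 0 ≤ M) (i : Fin n) :
    0 ≤ M i i := by
  obtain ⟨R, hR⟩ := exists_eq_sum_star_mul_of_nonneg hM
  rw [hR]
  exact Finset.sum_nonneg fun l _ => star_mul_self_nonneg _

/-- A self-adjoint matrix over a C⋆-algebra is positive if all its values
`∑ᵢⱼ bᵢ⋆ Mᵢⱼ bⱼ` are. -/
theorem nonneg_of_forall_sum_nonneg {M : CStarMatrix (Fin n) (Fin n) B} (hsa : IsSelfAdjoint M)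
    (hM : ∀ b : Fin n → B, 0 ≤ ∑ i, ∑ j, star (b i) * M i j * b j) : 0 ≤ M := by
  obtain ⟨N, hN0, hNMN, hN⟩ := exists_conjugate_eq_neg_cube hsa
  have hNs : IsSelfAdjoint N := IsSelfAdjoint.of_nonneg hN0
  have hN3 : 0 ≤ N * N * N := by
    have := star_left_conjugate_nonneg hN0 N
    rwa [hNs.star_eq] at this
  -- The columns of N serve as test vectors: (NMN)ₖₖ is one of the sums assumed nonnegative, but it
  -- equals −(N³)ₖₖ. Thus the positive matrix N³ has zero diagonal, which forces it to vanish.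
  have hdiag : ∀ k, (N * N * N) k k = 0 := by
    intro k
    refine le_antisymm ?_ (apply_self_nonneg hN3 k)
    have h1 : (N * M * N) k k = ∑ i, ∑ j, star (N i k) * M i j * N j k := by
      rw [CStarMatrix.mul_apply]
      simp only [CStarMatrix.mul_apply, Finset.sum_mul]
      rw [Finset.sum_comm]
      refine Finset.sum_congr rfl fun i _ => Finset.sum_congr rfl fun j _ => ?_
      rw [CStarMatrix.star_apply_of_isSelfAdjoint hNs]
    have h2 := hM fun i => N i k
    rw [← h1, hNMN, CStarMatrix.neg_apply] at h2
    exact neg_nonneg.1 h2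
  have hzero : N * N * N = 0 := by
    obtain ⟨R, hR⟩ := exists_eq_sum_star_mul_of_nonneg hN3
    have hR0 : ∀ l k, R l k = 0 := by
      intro l k
      have h1 := hdiag k
      rw [hR, Finset.sum_eq_zero_iff_of_nonneg fun l _ => star_mul_self_nonneg _] at h1
      exact CStarRing.star_mul_self_eq_zero_iff _ |>.1 (h1 l (Finset.mem_univ _))
    ext i j
    rw [hR]
    simp [hR0]
  exact hN hzero

end CStarMatrix

theorem star_sum_mul_sum {R : Type*} [NonUnitalSemiring R] [StarRing R] {n : ℕ} (c d : Fin n → R) :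
    star (∑ i, c i) * ∑ j, d j = ∑ i, ∑ j, star (c i) * d j := by
  rw [star_sum, Finset.sum_mul_sum]

namespace CompletelyPositiveMap

theorem map_star' (φ : A →CP B) (a : A) : φ (star a) = star (φ a) := map_star φ a

/-- The matrix `(φ(aᵢ⋆ aⱼ))ᵢⱼ` is positive. -/
theorem gram_nonneg (φ : A →CP B) {n : ℕ} (a : Fin n → A) :
    0 ≤ CStarMatrix.ofMatrix (Matrix.of fun i j => φ (star (a i) * a j)) := by
  have h : 0 ≤ CStarMatrix.ofMatrix (Matrix.of fun i j => star (a i) * a j) := by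
    refine CStarMatrix.nonneg_of_forall_sum_nonneg ?_ fun b => ?_
    · ext i j
      change star (star (a j) * a i) = star (a i) * a j
      rw [star_mul, star_star]
    · have : ∑ i, ∑ j, star (b i) * (star (a i) * a j) * b j
          = star (∑ i, a i * b i) * ∑ i, a i * b i := by
        rw [star_sum_mul_sum]
        simp only [star_mul, mul_assoc]
      exact this ▸ star_mul_self_nonneg _
  exact φ.map_cstarMatrix_nonneg _ h

/-- A linear map is completely positive if all `∑ᵢⱼ bᵢ⋆ f(aᵢ⋆ aⱼ) bⱼ` are positive. -/
def ofSumNonneg (f : A →ₗ[ℂ] B)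
    (hf : ∀ (n : ℕ) (a : Fin n → A) (b : Fin n → B),
      0 ≤ ∑ i, ∑ j, star (b i) * f (star (a i) * a j) * b j) : A →CP B where
  toLinearMap := f
  map_cstarMatrix_nonneg' n M hM := by
    -- The case n = 1, b = 1 of the hypothesis gives positivity, hence compatibility with ⋆; this
    -- supplies the self-adjointness that the matrix criterion requires.
    have hstar : ∀ a, f (star a) = star (f a) := by
      have hpos : ∀ a, 0 ≤ a → 0 ≤ f a := by
        intro a ha
        obtain ⟨c, rfl⟩ := CStarAlgebra.nonneg_iff_eq_star_mul_self.1 ha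
        simpa using hf 1 (fun _ => c) fun _ => 1
      intro a
      exact map_star (PositiveLinearMap.mk₀ f hpos) a
    refine CStarMatrix.nonneg_of_forall_sum_nonneg ?_ fun b => ?_
    · ext i j
      have hMs := (IsSelfAdjoint.of_nonneg hM)
      rw [CStarMatrix.star_apply, CStarMatrix.map_apply, CStarMatrix.map_apply, ← hstar,
        CStarMatrix.star_apply_of_isSelfAdjoint hMs]
    -- With M = R⋆R, each row of R contributes one sum of the assumed form.
    · obtain ⟨R, hR⟩ := CStarMatrix.exists_eq_sum_star_mul_of_nonneg hM
      have : ∑ i, ∑ j, star (b i) * M.map f i j * b j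
          = ∑ l, ∑ i, ∑ j, star (b i) * f (star (R l i) * R l j) * b j := by
        simp only [CStarMatrix.map_apply, hR, map_sum, Finset.mul_sum, Finset.sum_mul]
        conv_rhs => rw [Finset.sum_comm]
        refine Finset.sum_congr rfl fun i _ => ?_
        rw [Finset.sum_comm]
      rw [this]
      exact Finset.sum_nonneg fun l _ => hf n (R l) b

@[simp]
theorem ofSumNonneg_apply (f : A →ₗ[ℂ] B) (hf) (a : A) : ofSumNonneg f hf a = f a := rfl

end CompletelyPositiveMap

end Positivity

/-! ### Total families of operators -/

section Total

open scoped InnerProductSpace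

variable {ι : Type*} {K H E : Type*} [NormedAddCommGroup K] [InnerProductSpace ℂ K]
  [NormedAddCommGroup H] [InnerProductSpace ℂ H] [NormedAddCommGroup E] [InnerProductSpace ℂ E]

/-- A family of operators into `H` is total if their ranges span a dense subspace. -/
def IsTotalFamily (ε : ι → K →L[ℂ] H) : Prop :=
  (Submodule.span ℂ {h | ∃ i k, ε i k = h}).topologicalClosure = ⊤

namespace IsTotalFamily

variable {ε : ι → K →L[ℂ] H}

theorem induction (hε : IsTotalFamily ε) (p : Submodule ℂ H) (hp : IsClosed (p : Set H))
    (h : ∀ i k, ε i k ∈ p) (z : H) : z ∈ p := by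
  have : (Submodule.span ℂ {h | ∃ i k, ε i k = h}).topologicalClosure ≤ p :=
    Submodule.topologicalClosure_minimal _
      (Submodule.span_le.2 (by rintro _ ⟨i, k, rfl⟩; exact h i k)) hp
  exact this (hε ▸ Submodule.mem_top)

theorem clm_ext (hε : IsTotalFamily ε) {T S : H →L[ℂ] E} (h : ∀ i k, T (ε i k) = S (ε i k)) :
    T = S := by
  ext z
  exact hε.induction (LinearMap.eqLocus T.toLinearMap S.toLinearMap)
    (isClosed_eq T.continuous S.continuous) h z

theorem eq_of_forall_inner (hε : IsTotalFamily ε) {y z : H}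
    (h : ∀ i k, ⟪ε i k, y⟫_ℂ = ⟪ε i k, z⟫_ℂ) : y = z := by
  refine ext_inner_left ℂ fun t => ?_
  have := hε.induction
    { carrier := {t | ⟪t, y⟫_ℂ = ⟪t, z⟫_ℂ}
      add_mem' := fun {a b} ha hb => by
        simp only [Set.mem_ofPred_eq] at *
        rw [inner_add_left, inner_add_left, ha, hb]
      zero_mem' := by simp
      smul_mem' := fun c a ha => by
        simp only [Set.mem_ofPred_eq] at *
        rw [inner_smul_left, inner_smul_left, ha] }
    (isClosed_eq (by fun_prop) (by fun_prop)) h t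
  exact this

theorem mono {κ : Type*} (hε : IsTotalFamily ε) {δ : κ → K →L[ℂ] H} (f : ι → κ)
    (h : ∀ i k, δ (f i) k = ε i k) : IsTotalFamily δ := by
  rw [IsTotalFamily, eq_top_iff]
  rw [IsTotalFamily] at hε
  rw [← hε]
  refine Submodule.topologicalClosure_mono (Submodule.span_mono ?_)
  rintro _ ⟨i, k, rfl⟩
  exact ⟨f i, k, h i k⟩

/-- Both families define linear maps on finitely supported functions ι → K. The estimate lets the
second factor through the dense range of the first, including well-definedness. Operators on H are
specified on generators and produced by this lemma. -/
theorem exists_extension [CompleteSpace E] (hε : IsTotalFamily ε) (g : ι → K →L[ℂ] E) {C : ℝ}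
    (hC : 0 ≤ C)
    (h : ∀ (n : ℕ) (i : Fin n → ι) (k : Fin n → K),
      ‖∑ m, g (i m) (k m)‖ ≤ C * ‖∑ m, ε (i m) (k m)‖) :
    ∃ T : H →L[ℂ] E, ‖T‖ ≤ C ∧ ∀ i k, T (ε i k) = g i k := by
  classical
  let e : (ι →₀ K) →ₗ[ℂ] H := Finsupp.lsum ℂ fun i => (ε i : K →ₗ[ℂ] H)
  let f : (ι →₀ K) →ₗ[ℂ] E := Finsupp.lsum ℂ fun i => (g i : K →ₗ[ℂ] E)
  have he : ∀ i k, e (Finsupp.single i k) = ε i k := fun i k => by simp [e]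
  have hf : ∀ i k, f (Finsupp.single i k) = g i k := fun i k => by simp [f]
  have hdense : DenseRange e := by
    have h1 : Submodule.span ℂ {h | ∃ i k, ε i k = h} ≤ LinearMap.range e :=
      Submodule.span_le.2 (by rintro _ ⟨i, k, rfl⟩; exact ⟨_, he i k⟩)
    have h2 := Submodule.topologicalClosure_mono h1
    rw [hε, top_le_iff] at h2
    have h3 := (Submodule.dense_iff_topologicalClosure_eq_top).2 h2
    rwa [LinearMap.coe_range] at h3
  have hbound : ∀ d, ‖f d‖ ≤ C * ‖e d‖ := by
    intro d
    let q := d.support.equivFin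
    have h1 : e d = ∑ m, ε (q.symm m) (d (q.symm m)) := by
      rw [Equiv.sum_comp q.symm fun i : d.support => ε i (d i),
        Finset.sum_coe_sort d.support fun i => ε i (d i)]
      simp [e, Finsupp.sum]
    have h2 : f d = ∑ m, g (q.symm m) (d (q.symm m)) := by
      rw [Equiv.sum_comp q.symm fun i : d.support => g i (d i),
        Finset.sum_coe_sort d.support fun i => g i (d i)]
      simp [f, Finsupp.sum]
    rw [h1, h2]
    exact h _ (fun m => q.symm m) fun m => d (q.symm m)
  refine ⟨f.extendOfNorm e, LinearMap.opNorm_extendOfNorm_le hdense hC hbound,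
    fun i k => ?_⟩
  rw [← he, LinearMap.extendOfNorm_eq hdense ⟨C, hbound⟩, hf]

end IsTotalFamily

end Total

/-! ### Faithful representations of von Neumann algebras and normality -/

section Representation

open scoped InnerProductSpace ComplexOrder
open Filter Topology

variable {A : Type*} {B : Type*} [CStarAlgebra A] [PartialOrder A] [StarOrderedRing A]
  [CStarAlgebra B] [PartialOrder B] [StarOrderedRing B]
  {K : Type*} [NormedAddCommGroup K] [InnerProductSpace ℂ K] [CompleteSpace K]
  {H : Type*} [NormedAddCommGroup H] [InnerProductSpace ℂ H] [CompleteSpace H]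

/-- A faithful representation whose range equals its double commutant. -/
structure IsVNRep {B : Type*} [CStarAlgebra B] (l : B →⋆ₐ[ℂ] (K →L[ℂ] K)) : Prop where
  injective : Function.Injective l
  exists_eq : ∀ T : K →L[ℂ] K, (∀ c, (∀ b, Commute c (l b)) → Commute c T) → ∃ b, l b = T

theorem isVNRep_of_equiv {B : Type*} [CStarAlgebra B] (S : VonNeumannAlgebra K)
    (e : B ≃⋆ₐ[ℂ] S.toStarSubalgebra) :
    IsVNRep (S.toStarSubalgebra.subtype.comp (e : B →⋆ₐ[ℂ] S.toStarSubalgebra)) where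
  injective := Subtype.val_injective.comp e.injective
  exists_eq T hT := by
    have hmem : T ∈ Set.centralizer (Set.centralizer (S : Set (K →L[ℂ] K))) := by
      intro c hc
      refine hT c fun b => ?_
      exact (hc _ (e b).2).symm
    rw [S.centralizer_centralizer] at hmem
    refine ⟨e.symm ⟨T, hmem⟩, ?_⟩
    change ((e (e.symm ⟨T, hmem⟩) : S.toStarSubalgebra) : K →L[ℂ] K) = T
    rw [e.apply_symm_apply]

theorem inner_map_self_nonneg (l : B →⋆ₐ[ℂ] (K →L[ℂ] K)) {b : B} (hb : 0 ≤ b) (k : K) :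
    0 ≤ ⟪l b k, k⟫_ℂ :=
  ((ContinuousLinearMap.nonneg_iff_isPositive _).1 (map_nonneg l hb)).inner_nonneg_left k

theorem nonneg_of_forall_inner {l : B →⋆ₐ[ℂ] (K →L[ℂ] K)} (hl : Function.Injective l) {b : B}
    (h : ∀ k, 0 ≤ ⟪l b k, k⟫_ℂ) : 0 ≤ b := by
  rw [← l.nonneg_iff_of_injective hl, ContinuousLinearMap.nonneg_iff_isPositive,
    ContinuousLinearMap.isPositive_iff_complex]
  intro k
  have := h k
  rw [RCLike.nonneg_iff] at this
  exact ⟨Complex.ext rfl this.2.symm, this.1⟩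

/-- With P = R⋆R this is ‖R⋆Rk‖² ≤ ‖R‖²‖Rk‖². It upgrades convergence of quadratic forms to strong
convergence. -/
theorem norm_sq_apply_le_of_nonneg {P : K →L[ℂ] K} (hP : 0 ≤ P) (k : K) :
    ‖P k‖ ^ 2 ≤ ‖P‖ * (⟪P k, k⟫_ℂ).re := by
  obtain ⟨R, hR⟩ := exists_star_mul_self_of_nonneg hP
  have h1 : (⟪P k, k⟫_ℂ).re = ‖R k‖ ^ 2 := by
    rw [hR, mul_apply_eq_comp, ContinuousLinearMap.star_eq_adjoint,
      ContinuousLinearMap.adjoint_inner_left]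
    exact inner_self_eq_norm_sq (𝕜 := ℂ) (R k)
  have h2 : ‖P‖ = ‖R‖ ^ 2 := by rw [hR, CStarRing.norm_star_mul_self, pow_two]
  have h3 : ‖P k‖ ≤ ‖R‖ * ‖R k‖ := by
    rw [hR, mul_apply_eq_comp]
    refine ((star R).le_opNorm _).trans ?_
    rw [norm_star]
  rw [h1, h2, ← mul_pow]
  gcongr

/-- A decreasing net of positive operators converges strongly. -/
theorem exists_tendsto_of_antitone_nonneg {I : Type*} [Preorder I] [IsDirectedOrder I]
    [Nonempty I] {T : I → K →L[ℂ] K} (hT : Antitone T) (h0 : ∀ i, 0 ≤ T i) :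
    ∃ L : K →L[ℂ] K, ∀ k, Tendsto (fun i => T i k) atTop (𝓝 (L k)) := by
  obtain ⟨i₀⟩ := ‹Nonempty I›
  have hnorm : ∀ i j, i₀ ≤ i → i ≤ j → ‖T i - T j‖ ≤ ‖T i₀‖ := by
    intro i j hi hij
    refine CStarAlgebra.norm_le_norm_of_nonneg_of_le (sub_nonneg.2 (hT hij)) ?_
    exact (sub_le_self _ (h0 j)).trans (hT hi)
  have hlim : ∀ k, ∃ y, Tendsto (fun i => T i k) atTop (𝓝 y) := by
    intro k
    set r : I → ℝ := fun i => (⟪T i k, k⟫_ℂ).re with hr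
    have hre : ∀ i j, i ≤ j → (⟪(T i - T j) k, k⟫_ℂ).re = r i - r j := by
      intro i j _
      simp [hr]
    have hpos : ∀ P : K →L[ℂ] K, 0 ≤ P → 0 ≤ (⟪P k, k⟫_ℂ).re := fun P hP =>
      ((ContinuousLinearMap.nonneg_iff_isPositive P).1 hP).re_inner_nonneg_left k
    have hanti : Antitone r := fun i j hij => by
      have := hpos _ (sub_nonneg.2 (hT hij))
      rw [hre i j hij] at this
      linarith
    have hbdd : BddBelow (Set.range r) := ⟨0, by rintro _ ⟨i, rfl⟩; exact hpos _ (h0 i)⟩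
    have htend := tendsto_atTop_ciInf hanti hbdd
    refine cauchy_map_iff_exists_tendsto.1 (Metric.cauchy_iff.2 ⟨inferInstance, fun ε hε => ?_⟩)
    -- C dominates ‖T N − T i‖ beyond i₀, and the added 1 permits division by it. The decreasing
    -- quadratic forms converge, so their differences eventually fall below (ε/2)²/C.
    set C : ℝ := ‖T i₀‖ + 1 with hC
    have hC0 : 0 < C := by positivity
    have hev : ∀ᶠ i in atTop, r i < (⨅ i, r i) + (ε / 2) ^ 2 / C :=
      htend.eventually (gt_mem_nhds (lt_add_of_pos_right _ (by positivity)))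
    obtain ⟨N, hN, hN0⟩ := (hev.and (eventually_ge_atTop i₀)).exists
    refine ⟨(fun i => T i k) '' Set.Ici N, image_mem_map (Ici_mem_atTop N), ?_⟩
    have key : ∀ i, N ≤ i → dist (T N k) (T i k) < ε / 2 := by
      intro i hi
      rw [dist_eq_norm]
      have h1 := norm_sq_apply_le_of_nonneg (sub_nonneg.2 (hT hi)) k
      rw [hre _ _ hi, sub_apply] at h1
      have h2 : r N - r i < (ε / 2) ^ 2 / C := by linarith [ciInf_le hbdd i]
      have h3 : 0 ≤ r N - r i := sub_nonneg.2 (hanti hi)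
      have h4 : ‖T N k - T i k‖ ^ 2 < (ε / 2) ^ 2 := by
        calc ‖T N k - T i k‖ ^ 2 ≤ ‖T N - T i‖ * (r N - r i) := h1
          _ ≤ C * (r N - r i) := by
            gcongr
            linarith [hnorm N i hN0 hi]
          _ < C * ((ε / 2) ^ 2 / C) := by gcongr
          _ = (ε / 2) ^ 2 := by field_simp
      exact lt_of_pow_lt_pow_left₀ 2 (by positivity) h4
    rintro _ ⟨i, hi, rfl⟩ _ ⟨j, hj, rfl⟩
    calc dist (T i k) (T j k) ≤ dist (T N k) (T i k) + dist (T N k) (T j k) :=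
          dist_triangle_left _ _ _
      _ < ε / 2 + ε / 2 := add_lt_add (key i hi) (key j hj)
      _ = ε := by ring
  choose L hL using hlim
  refine ⟨LinearMap.mkContinuous
    { toFun := L
      map_add' := fun x y => tendsto_nhds_unique (hL _) (by simpa using (hL x).add (hL y))
      map_smul' := fun c x => tendsto_nhds_unique (hL _) (by simpa using (hL x).const_smul c) }
    ‖T i₀‖ fun x => ?_, hL⟩
  refine le_of_tendsto (hL x).norm ?_
  filter_upwards [eventually_ge_atTop i₀] with i hi
  refine ((T i).le_opNorm x).trans ?_
  gcongr
  exact CStarAlgebra.norm_le_norm_of_nonneg_of_le (h0 i) (hT hi)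

/-- Bounded increasing nets converge in the weak operator topology to their supremum. -/
theorem IsVNRep.tendsto_of_isLUB {l : B →⋆ₐ[ℂ] (K →L[ℂ] K)} (hl : IsVNRep l) {I : Type*}
    [Preorder I] [IsDirectedOrder I] [Nonempty I] {g : I → B} (hg : Monotone g) {s : B}
    (hs : IsLUB (Set.range g) s) (k : K) :
    Tendsto (fun i => ⟪l (s - g i) k, k⟫_ℂ) atTop (𝓝 0) := by
  have hgs : ∀ i, g i ≤ s := fun i => hs.1 ⟨i, rfl⟩
  have hanti : Antitone fun i => l (s - g i) := fun i j hij =>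
    OrderHomClass.mono l (sub_le_sub_left (hg hij) s)
  obtain ⟨L, hL⟩ := exists_tendsto_of_antitone_nonneg hanti fun i =>
    map_nonneg l (sub_nonneg.2 (hgs i))
  -- The strong limit L commutes with the commutant, so it is the image of some c in B. Then c ≥ 0
  -- and s − c is still an upper bound of the net, whence c = 0.
  obtain ⟨c, hc⟩ := hl.exists_eq L fun T hT => by
    ext k
    have h1 : Tendsto (fun i => T (l (s - g i) k)) atTop (𝓝 (T (L k))) :=
      (T.continuous.tendsto _).comp (hL k)
    have h2 : ∀ i, T (l (s - g i) k) = l (s - g i) (T k) := fun i =>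
      DFunLike.congr_fun (hT (s - g i)).eq k
    simp only [h2] at h1
    exact tendsto_nhds_unique h1 (hL (T k))
  have hinner : ∀ k, Tendsto (fun i => ⟪l (s - g i) k, k⟫_ℂ) atTop (𝓝 ⟪L k, k⟫_ℂ) := fun k =>
    (hL k).inner tendsto_const_nhds
  have hc0 : 0 ≤ c := nonneg_of_forall_inner hl.injective fun k => by
    rw [hc]
    exact ge_of_tendsto' (hinner k) fun i =>
      inner_map_self_nonneg l (sub_nonneg.2 (hgs i)) k
  have hcs : s ≤ s - c := by
    refine hs.2 ?_
    rintro _ ⟨i, rfl⟩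
    rw [le_sub_comm, ← sub_nonneg]
    refine nonneg_of_forall_inner hl.injective fun k => ?_
    have h1 : Tendsto (fun j => ⟪l (s - g i) k, k⟫_ℂ - ⟪l (s - g j) k, k⟫_ℂ) atTop
        (𝓝 (⟪l (s - g i) k, k⟫_ℂ - ⟪L k, k⟫_ℂ)) := tendsto_const_nhds.sub (hinner k)
    rw [map_sub, hc, sub_apply, inner_sub_left]
    refine ge_of_tendsto h1 ?_
    filter_upwards [eventually_ge_atTop i] with j hij
    rw [← inner_sub_left, ← sub_apply, ← map_sub, sub_sub_sub_cancel_left]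
    exact inner_map_self_nonneg l (sub_nonneg.2 (hg hij)) k
  have hc1 : c = 0 := le_antisymm (by simpa using hcs) hc0
  have := hinner k
  rw [← hc, hc1, map_zero] at this
  simpa using this

/-- An operator-valued map is weakly normal if it maps bounded increasing nets of self-adjoint
elements to weakly convergent nets. -/
def IsWeaklyNormal (T : A → (K →L[ℂ] K)) : Prop :=
  ∀ D : Set A, (∀ d ∈ D, IsSelfAdjoint d) → D.Nonempty → DirectedOn (· ≤ ·) D →
    ∀ s : A, IsLUB D s → ∀ k, Tendsto (fun d : D => ⟪T (s - d) k, k⟫_ℂ) atTop (𝓝 0)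

/-- Normality makes f s the supremum of the images, and in a representation with the double
commutant property suprema of increasing nets are weak limits. -/
theorem IsNormalMap.isWeaklyNormal_comp {A : Type*} [CStarAlgebra A] [PartialOrder A]
    {f : A → B} (hf : IsNormalMap f)
    (hsub : ∀ a b, f (a - b) = f a - f b) (hmono : Monotone f) {l : B →⋆ₐ[ℂ] (K →L[ℂ] K)}
    (hl : IsVNRep l) : IsWeaklyNormal fun a => l (f a) := by
  intro D hsa hne hdir s hs k
  have : Nonempty D := hne.to_subtype
  have : IsDirectedOrder D := directedOn_iff_isDirectedOrder.1 hdir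
  have h := hl.tendsto_of_isLUB (g := fun d : D => f d)
    (fun a b hab => hmono hab) (s := f s) (by
      have := hf D hsa hne hdir s hs
      rwa [← Set.image_eq_range]) k
  simpa only [hsub] using h

/-- For an upper bound u of the images, (u − f s) + f(s − d) = u − f d is positive, and its
quadratic forms converge to those of u − f s. Only faithfulness is needed in this direction. -/
theorem isNormalMap_of_isWeaklyNormal_comp {A : Type*} [CStarAlgebra A] [PartialOrder A]
    {f : A → B} (hsub : ∀ a b, f (a - b) = f a - f b) (hmono : Monotone f)
    {l : B →⋆ₐ[ℂ] (K →L[ℂ] K)} (hl : Function.Injective l)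
    (h : IsWeaklyNormal fun a => l (f a)) : IsNormalMap f := by
  intro D hsa hne hdir s hs
  have : Nonempty D := hne.to_subtype
  have : IsDirectedOrder D := directedOn_iff_isDirectedOrder.1 hdir
  refine ⟨?_, fun u hu => ?_⟩
  · rintro _ ⟨d, hd, rfl⟩
    exact hmono (hs.1 hd)
  · rw [← sub_nonneg]
    refine nonneg_of_forall_inner hl fun k => ?_
    have h1 : Tendsto (fun d : D => ⟪l (u - f s) k, k⟫_ℂ + ⟪l (f (s - d)) k, k⟫_ℂ) atTop
        (𝓝 (⟪l (u - f s) k, k⟫_ℂ + 0)) := tendsto_const_nhds.add (h D hsa hne hdir s hs k)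
    rw [add_zero] at h1
    refine ge_of_tendsto' h1 fun d => ?_
    rw [← inner_add_left, ← add_apply, ← map_add, hsub, sub_add_sub_cancel]
    exact inner_map_self_nonneg l (sub_nonneg.2 (hu ⟨d, d.2, rfl⟩)) k

theorem IsVNRep.isWeaklyNormal {l : B →⋆ₐ[ℂ] (K →L[ℂ] K)} (hl : IsVNRep l) :
    IsWeaklyNormal l := by
  refine IsNormalMap.isWeaklyNormal_comp (f := fun b : B => b) ?_ (fun _ _ => rfl) monotone_id hl
  intro D _ _ _ s hs
  rwa [Set.image_id']

/-- The quadratic form of c⋆bc at k is that of b at l(c)k. -/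
theorem IsVNRep.isNormalMap_conjugate {l : B →⋆ₐ[ℂ] (K →L[ℂ] K)} (hl : IsVNRep l) (c : B) :
    IsNormalMap fun b : B => star c * b * c := by
  refine isNormalMap_of_isWeaklyNormal_comp (fun a b => by rw [mul_sub, sub_mul])
    (fun a b hab => star_left_conjugate_le_conjugate hab c) hl.injective ?_
  intro D hsa hne hdir s hs k
  have h := hl.isWeaklyNormal D hsa hne hdir s hs (l c k)
  refine h.congr fun d => ?_
  simp only [map_mul, map_star, mul_apply_eq_comp, ContinuousLinearMap.star_eq_adjoint,
    ContinuousLinearMap.adjoint_inner_left]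

theorem IsNormalMap.comp {A B C : Type*} [CStarAlgebra A] [PartialOrder A] [CStarAlgebra B]
    [PartialOrder B] [CStarAlgebra C] [PartialOrder C] {g : B → C} {f : A → B}
    (hg : IsNormalMap g) (hf : IsNormalMap f) (hmono : Monotone f)
    (hsa : ∀ a, IsSelfAdjoint a → IsSelfAdjoint (f a)) : IsNormalMap fun a => g (f a) := by
  intro D hD hne hdir s hs
  have := hg (f '' D) (by rintro _ ⟨d, hd, rfl⟩; exact hsa d (hD d hd)) (hne.image f)
    (hdir.mono_comp fun _ _ h => hmono h) (f s) (hf D hD hne hdir s hs)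
  rwa [Set.image_image] at this

end Representation

/-! ### Stinespring dilations -/

section Stinespring

open scoped InnerProductSpace ComplexOrder
open Filter Topology

variable {A : Type*} {B : Type*} [CStarAlgebra A] [PartialOrder A] [StarOrderedRing A]
  [CStarAlgebra B] [PartialOrder B] [StarOrderedRing B]
  {K : Type*} [NormedAddCommGroup K] [InnerProductSpace ℂ K] [CompleteSpace K]
  {H : Type*} [NormedAddCommGroup H] [InnerProductSpace ℂ H]

/-- The operators `ε a : K → H` are the maps `k ↦ a ⊗ k` into the Hilbert space of the Stinespring
dilation of `l ∘ φ`, where `l` represents `B` on `K`. -/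
structure IsStinespring (φ : A →CP B) (l : B →⋆ₐ[ℂ] (K →L[ℂ] K)) (ε : A → K →L[ℂ] H) :
    Prop where
  inner_eq (a α : A) (k k' : K) : ⟪ε a k, ε α k'⟫_ℂ = ⟪k, l (φ (star a * α)) k'⟫_ℂ
  total : IsTotalFamily ε

/-- With M = R⋆R the double sum is ∑ₘ ‖∑ᵢ l(Rₘᵢ)kᵢ‖². -/
theorem CStarMatrix.sum_inner_map_nonneg {n : ℕ} {M : CStarMatrix (Fin n) (Fin n) B}
    (hM : 0 ≤ M) (l : B →⋆ₐ[ℂ] (K →L[ℂ] K)) (k : Fin n → K) :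
    0 ≤ ∑ i, ∑ j, ⟪k i, l (M i j) (k j)⟫_ℂ := by
  obtain ⟨R, hR⟩ := exists_eq_sum_star_mul_of_nonneg hM
  have h : ∑ i, ∑ j, ⟪k i, l (M i j) (k j)⟫_ℂ
      = ∑ m, ⟪∑ i, l (R m i) (k i), ∑ i, l (R m i) (k i)⟫_ℂ := by
    simp only [hR, map_sum, map_mul, map_star, sum_apply, inner_sum,
      sum_inner, mul_apply_eq_comp, ContinuousLinearMap.star_eq_adjoint,
      ContinuousLinearMap.adjoint_inner_right]
    conv_rhs => rw [Finset.sum_comm]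
    rw [Finset.sum_comm]
    refine Finset.sum_congr rfl fun i _ => ?_
    rw [Finset.sum_comm]
  rw [h]
  exact Finset.sum_nonneg fun m _ => by
    rw [inner_self_eq_norm_sq_to_K]
    positivity

theorem sum_inner_map_gram_nonneg (φ : A →CP B) (l : B →⋆ₐ[ℂ] (K →L[ℂ] K)) {n : ℕ}
    (a : Fin n → A) (k : Fin n → K) :
    0 ≤ ∑ i, ∑ j, ⟪k i, l (φ (star (a i) * a j)) (k j)⟫_ℂ :=
  CStarMatrix.sum_inner_map_nonneg (φ.gram_nonneg a) l k

/-- Complete positivity says that the operator-valued kernel (a, α) ↦ l(φ(a⋆α)) is positive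
semidefinite. Its reproducing kernel Hilbert space is H, and ε a is the kernel function at a. -/
theorem exists_isStinespring {A : Type u} [CStarAlgebra A] [PartialOrder A] [StarOrderedRing A]
    {K : Type v} [NormedAddCommGroup K] [InnerProductSpace ℂ K] [CompleteSpace K]
    (φ : A →CP B) (l : B →⋆ₐ[ℂ] (K →L[ℂ] K)) :
    ∃ (H : Type (max u v)) (_ : NormedAddCommGroup H) (_ : InnerProductSpace ℂ H)
      (_ : CompleteSpace H) (ε : A → K →L[ℂ] H), IsStinespring φ l ε := by
  classical
  let M : Matrix A A (K →L[ℂ] K) := Matrix.of fun a α => l (φ (star a * α))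
  have hM : M.PosSemidef := by
    have hiff := (RKHS.posSemidef_tfae (𝕜 := ℂ) (K := M)).out 0 2
    refine hiff.2 ⟨?_, fun d => ?_⟩
    · ext a α : 2
      simp only [M, Matrix.conjTranspose_apply, Matrix.of_apply]
      rw [← map_star, ← φ.map_star', star_mul, star_star]
    · have h := sum_inner_map_gram_nonneg φ l (fun m => (d.support.equivFin.symm m : A))
        (fun m => d (d.support.equivFin.symm m))
      have hsum : ∀ F : A → ℂ, ∑ m, F (d.support.equivFin.symm m) = ∑ i ∈ d.support, F i :=
        fun F => by
          rw [Equiv.sum_comp d.support.equivFin.symm fun i : d.support => F i,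
            Finset.sum_coe_sort d.support F]
      have h2 : ∑ i, ∑ j, ⟪d (d.support.equivFin.symm i), l (φ (star (d.support.equivFin.symm i : A)
          * d.support.equivFin.symm j)) (d (d.support.equivFin.symm j))⟫_ℂ
          = ∑ x ∈ d.support, ∑ x' ∈ d.support, ⟪d x, l (φ (star x * x')) (d x')⟫_ℂ := by
        rw [← hsum]
        exact Finset.sum_congr rfl fun i _ => hsum fun x' => ⟪_, l (φ (star _ * x')) (d x')⟫_ℂ
      rw [h2] at h
      refine (RCLike.nonneg_iff.1 h).1.trans_eq ?_
      refine congrArg _ (Finset.sum_congr rfl fun x _ => Finset.sum_congr rfl fun x' _ => ?_)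
      change _ = ⟪l (φ (star x' * x)) (d x), d x'⟫_ℂ
      rw [← ContinuousLinearMap.adjoint_inner_right, ← ContinuousLinearMap.star_eq_adjoint,
        ← map_star, ← φ.map_star', star_mul, star_star]
  have : Fact M.PosSemidef := ⟨hM⟩
  refine ⟨RKHS.OfKernel M, inferInstance, inferInstance, inferInstance,
    fun a => RKHS.kerFun (RKHS.OfKernel M) a, ⟨fun a α k k' => ?_, RKHS.kerFun_dense _⟩⟩
  rw [RKHS.kerFun_inner, RKHS.kerFun_apply, RKHS.OfKernel.kernel_ofKernel]
  rfl

namespace IsStinespring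

variable {φ : A →CP B} {l : B →⋆ₐ[ℂ] (K →L[ℂ] K)} {ε : A → K →L[ℂ] H}

/-- Linearity of ε is not part of the structure: the prescribed inner products and totality force
it. -/
theorem map_add (h : IsStinespring φ l ε) (a b : A) : ε (a + b) = ε a + ε b := by
  ext k
  refine h.total.eq_of_forall_inner fun α k' => ?_
  simp [h.inner_eq, mul_add]

theorem map_smul (h : IsStinespring φ l ε) (c : ℂ) (a : A) : ε (c • a) = c • ε a := by
  ext k
  refine h.total.eq_of_forall_inner fun α k' => ?_
  simp [h.inner_eq]

theorem norm_sq_sum (h : IsStinespring φ l ε) {n : ℕ} (a : Fin n → A) (k : Fin n → K) :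
    ‖∑ i, ε (a i) (k i)‖ ^ 2
      = (∑ i, ∑ j, ⟪k i, l (φ (star (a i) * a j)) (k j)⟫_ℂ).re := by
  rw [← inner_self_eq_norm_sq (𝕜 := ℂ)]
  simp only [inner_sum, sum_inner, h.inner_eq]
  rw [Finset.sum_comm]
  rfl

/-- Write ‖a₀‖² − a₀⋆a₀ = c⋆c. Then ‖∑ caᵢ ⊗ kᵢ‖² is exactly the difference of the squares of the
two sides, hence that difference is nonnegative. -/
theorem norm_sum_mul_le (h : IsStinespring φ l ε) (a₀ : A) {n : ℕ} (a : Fin n → A)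
    (k : Fin n → K) : ‖∑ i, ε (a₀ * a i) (k i)‖ ≤ ‖a₀‖ * ‖∑ i, ε (a i) (k i)‖ := by
  obtain ⟨c, hc⟩ := exists_star_mul_self_of_nonneg
    (sub_nonneg.2 (CStarAlgebra.star_mul_le_algebraMap_norm_sq (a := a₀)))
  have hc' : star c * c = ((‖a₀‖ ^ 2 : ℝ) : ℂ) • (1 : A) - star a₀ * a₀ := by
    rw [← hc, Algebra.algebraMap_eq_smul_one, Complex.coe_smul]
  have key : ‖∑ i, ε (c * a i) (k i)‖ ^ 2
      = ‖a₀‖ ^ 2 * ‖∑ i, ε (a i) (k i)‖ ^ 2 - ‖∑ i, ε (a₀ * a i) (k i)‖ ^ 2 := by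
    rw [h.norm_sq_sum, h.norm_sq_sum, h.norm_sq_sum, ← Complex.re_ofReal_mul, ← Complex.sub_re]
    congr 1
    simp only [Finset.mul_sum, ← Finset.sum_sub_distrib]
    refine Finset.sum_congr rfl fun i _ => Finset.sum_congr rfl fun j _ => ?_
    have : star (c * a i) * (c * a j)
        = ((‖a₀‖ ^ 2 : ℝ) : ℂ) • (star (a i) * a j) - star (a₀ * a i) * (a₀ * a j) := by
      rw [star_mul, star_mul, mul_assoc, ← mul_assoc (star c), hc', sub_mul, mul_sub,
        smul_mul_assoc, one_mul, mul_smul_comm]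
      simp only [mul_assoc]
    rw [this]
    simp only [map_sub, _root_.map_smul, sub_apply, smul_apply, inner_sub_right,
      inner_smul_right]
  have h0 := sq_nonneg ‖∑ i, ε (c * a i) (k i)‖
  rw [key, ← mul_pow] at h0
  exact (pow_le_pow_iff_left₀ (norm_nonneg _) (by positivity) two_ne_zero).1 (by linarith)

variable [CompleteSpace H]

/-- The representation of `A` on the Stinespring space. -/
theorem exists_rep (h : IsStinespring φ l ε) :
    ∃ π : A →⋆ₐ[ℂ] (H →L[ℂ] H), ∀ a α k, π a (ε α k) = ε (a * α) k := by
  have hex : ∀ a₀ : A, ∃ T : H →L[ℂ] H, ‖T‖ ≤ ‖a₀‖ ∧ ∀ a k, T (ε a k) = ε (a₀ * a) k :=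
    fun a₀ => h.total.exists_extension (fun a => ε (a₀ * a)) (norm_nonneg _)
      fun n a k => h.norm_sum_mul_le a₀ a k
  choose π hπ' hπ using hex
  refine ⟨
    { toFun := π
      map_one' := h.total.clm_ext fun a k => by rw [hπ, one_mul]; rfl
      map_mul' := fun a b => h.total.clm_ext fun α k => by
        rw [mul_apply_eq_comp, hπ, hπ, hπ, mul_assoc]
      map_zero' := h.total.clm_ext fun α k => by
        rw [hπ, zero_mul, zero_apply]
        simpa using DFunLike.congr_fun (h.map_smul 0 0) k
      map_add' := fun a b => h.total.clm_ext fun α k => by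
        rw [add_apply, hπ, hπ, hπ, add_mul, h.map_add, add_apply]
      commutes' := fun c => h.total.clm_ext fun α k => by
        rw [hπ, Algebra.algebraMap_eq_smul_one, Algebra.algebraMap_eq_smul_one, smul_mul_assoc,
          one_mul, h.map_smul]
        rfl
      map_star' := fun a => h.total.clm_ext fun α k => h.total.eq_of_forall_inner fun β k' => by
        rw [hπ, ContinuousLinearMap.star_eq_adjoint, ContinuousLinearMap.adjoint_inner_right, hπ,
          h.inner_eq, h.inner_eq, star_mul, mul_assoc] },
    fun a α k => hπ a α k⟩

/-- The representation of the commutant of `B` on the Stinespring space. -/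
theorem exists_commutant_rep (h : IsStinespring φ l ε) {c : K →L[ℂ] K}
    (hc : ∀ b, Commute c (l b)) :
    ∃ T : H →L[ℂ] H, ∀ a k, T (ε a k) = ε a (c k) := by
  set q : K →L[ℂ] K := algebraMap ℝ _ (‖c‖ ^ 2) - star c * c with hq
  have hq0 : 0 ≤ q := sub_nonneg.2 (CStarAlgebra.star_mul_le_algebraMap_norm_sq (a := c))
  have hqb : ∀ b, Commute q (l b) := fun b => by
    have h1 : Commute (star c) (l b) := by
      have := (hc (star b)).star_star
      rwa [map_star, star_star] at this
    exact (Algebra.commute_algebraMap_left _ _).sub_left (h1.mul_left (hc b))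
  -- As a function of q, the defect root d again commutes with l(B). So c and d both move past
  -- l(φ(a⋆α)), and the squared norm of ∑ aᵢ ⊗ dkᵢ measures the slack in the required estimate.
  set d : K →L[ℂ] K := CFC.sqrt q with hd
  have hds : star d = d := (IsSelfAdjoint.of_nonneg (CFC.sqrt_nonneg q)).star_eq
  have hdd : star d * d = q := by rw [hds, CFC.sqrt_mul_sqrt_self q]
  have hdb : ∀ b, Commute d (l b) := fun b => (hqb b).cfcₙ_nnreal _
  have hform : ∀ (e : K →L[ℂ] K), (∀ b, Commute e (l b)) → ∀ (n : ℕ) (a : Fin n → A)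
      (k : Fin n → K), ‖∑ i, ε (a i) (e (k i))‖ ^ 2
        = (∑ i, ∑ j, ⟪k i, (star e * e) (l (φ (star (a i) * a j)) (k j))⟫_ℂ).re := by
    intro e he n a k
    rw [h.norm_sq_sum]
    congr 1
    refine Finset.sum_congr rfl fun i _ => Finset.sum_congr rfl fun j _ => ?_
    rw [mul_apply_eq_comp, ContinuousLinearMap.star_eq_adjoint,
      ContinuousLinearMap.adjoint_inner_right]
    congr 1
    exact (DFunLike.congr_fun (he _).eq (k j)).symm
  obtain ⟨T, -, hT⟩ := h.total.exists_extension (fun a => ε a ∘L c) (norm_nonneg c)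
    fun n a k => by
      have key : ‖∑ i, ε (a i) (d (k i))‖ ^ 2
          = ‖c‖ ^ 2 * ‖∑ i, ε (a i) (k i)‖ ^ 2 - ‖∑ i, ε (a i) (c (k i))‖ ^ 2 := by
        rw [hform d hdb, hform c hc, h.norm_sq_sum, ← Complex.re_ofReal_mul, ← Complex.sub_re,
          hdd, hq]
        congr 1
        simp only [Finset.mul_sum, ← Finset.sum_sub_distrib]
        refine Finset.sum_congr rfl fun i _ => Finset.sum_congr rfl fun j _ => ?_
        rw [sub_apply, inner_sub_right, Algebra.algebraMap_eq_smul_one, ← Complex.coe_smul,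
          smul_apply, inner_smul_right]
        rfl
      have h0 := sq_nonneg ‖∑ i, ε (a i) (d (k i))‖
      rw [key, ← mul_pow] at h0
      exact (pow_le_pow_iff_left₀ (norm_nonneg _) (by positivity) two_ne_zero).1 (by
        simpa using h0)
  exact ⟨T, hT⟩

/-- The representation on the Stinespring space of a normal completely positive map is normal. -/
theorem isWeaklyNormal_rep (h : IsStinespring φ l ε) (hl : IsVNRep l) (hφ : IsNormalMap φ)
    (hA : IsVonNeumannAlgebra A) {π : A →⋆ₐ[ℂ] (H →L[ℂ] H)}
    (hπ : ∀ a α k, π a (ε α k) = ε (a * α) k) : IsWeaklyNormal π := by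
  intro D hsa hne hdir s hs
  have : Nonempty D := hne.to_subtype
  have : IsDirectedOrder D := directedOn_iff_isDirectedOrder.1 hdir
  have he : ∀ d : D, 0 ≤ s - d := fun d => sub_nonneg.2 (hs.1 d.2)
  set r : D → A := fun d => CFC.sqrt (s - d) with hr
  have hrs : ∀ d, star (r d) = r d := fun d =>
    (IsSelfAdjoint.of_nonneg (CFC.sqrt_nonneg _)).star_eq
  have hrr : ∀ d, star (r d) * r d = s - d := fun d => by
    rw [hrs, hr]
    exact CFC.sqrt_mul_sqrt_self _ (he d)
  have hsq : ∀ (d : D) (z : H), ⟪π (s - d) z, z⟫_ℂ = (‖π (r d) z‖ : ℂ) ^ 2 := by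
    intro d z
    rw [← hrr, map_mul, map_star, mul_apply_eq_comp, ContinuousLinearMap.star_eq_adjoint,
      ContinuousLinearMap.adjoint_inner_left]
    exact inner_self_eq_norm_sq_to_K (𝕜 := ℂ) _
  -- Passing to the square roots turns convergence of quadratic forms into convergence of vectors.
  -- This condition on z defines a linear subspace, so it suffices that the subspace is closed and
  -- contains the generators.
  have hmain : ∀ z, Tendsto (fun d => π (r d) z) atTop (𝓝 0) := by
    let p : Submodule ℂ H :=
      { carrier := {z | Tendsto (fun d => π (r d) z) atTop (𝓝 0)}
        add_mem' := fun {a b} ha hb => by simpa using Tendsto.add ha hb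
        zero_mem' := by simp
        smul_mem' := fun c a ha => by simpa using Tendsto.const_smul ha c }
    have hclosed : IsClosed (p : Set H) := by
      obtain ⟨d₀⟩ := ‹Nonempty D›
      -- Beyond d₀ the roots are uniformly bounded, since ‖r d‖² = ‖s − d‖ decreases; the uniform
      -- bound makes the subspace closed.
      set C : ℝ := ‖r d₀‖ + 1 with hC
      have hC0 : 0 < C := by positivity
      have hbound : ∀ d, d₀ ≤ d → ‖π (r d)‖ ≤ C := fun d hd => by
        have h1 : ‖r d‖ ≤ ‖r d₀‖ := by
          refine (pow_le_pow_iff_left₀ (norm_nonneg _) (norm_nonneg _) two_ne_zero).1 ?_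
          rw [pow_two, pow_two, ← CStarRing.norm_star_mul_self, ← CStarRing.norm_star_mul_self,
            hrr, hrr]
          exact CStarAlgebra.norm_le_norm_of_nonneg_of_le (he d) 
            (sub_le_sub_left (α := A) hd s)
        linarith [NonUnitalStarAlgHom.norm_apply_le π (r d)]
      refine isClosed_of_closure_subset fun z hz => ?_
      refine Metric.tendsto_nhds.2 fun δ hδ => ?_
      obtain ⟨z', hz', hd⟩ := Metric.mem_closure_iff.1 hz (δ / 2 / C) (by positivity)
      filter_upwards [eventually_ge_atTop d₀, Metric.tendsto_nhds.1 hz' (δ / 2) (by positivity)]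
        with d h1 h2
      rw [dist_zero_right] at h2 ⊢
      have h3 : ‖π (r d) (z - z')‖ ≤ C * ‖z - z'‖ :=
        ((π (r d)).le_opNorm _).trans (by gcongr; exact hbound d h1)
      rw [dist_eq_norm, lt_div_iff₀' hC0] at hd
      calc ‖π (r d) z‖ = ‖π (r d) (z - z') + π (r d) z'‖ := by rw [map_sub, sub_add_cancel]
        _ ≤ ‖π (r d) (z - z')‖ + ‖π (r d) z'‖ := norm_add_le _ _
        _ < δ := by linarith
    refine fun z => h.total.induction p hclosed (fun a k => ?_) z
    obtain ⟨H', _, _, _, S, ⟨e⟩⟩ := hA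
    -- On the generator a ⊗ k the quadratic form of π(s − d) is that of l(φ(a⋆(s − d)a)) at k.
    have hnorm : IsNormalMap fun α => φ (star a * α * a) :=
      hφ.comp ((isVNRep_of_equiv S e).isNormalMap_conjugate a)
        (fun _ _ hab => star_left_conjugate_le_conjugate hab a) fun α hα => hα.conjugate' a
    have hw := hnorm.isWeaklyNormal_comp (fun a b => by rw [mul_sub, sub_mul, map_sub])
      (fun _ _ hab => OrderHomClass.mono φ (star_left_conjugate_le_conjugate hab a)) hl
      D hsa hne hdir s hs k
    have h1 : ∀ d : D, ⟪l (φ (star a * (s - d) * a)) k, k⟫_ℂ = (‖π (r d) (ε a k)‖ : ℂ) ^ 2 := by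
      intro d
      rw [← hsq, hπ, h.inner_eq, ← ContinuousLinearMap.adjoint_inner_left,
        ← ContinuousLinearMap.star_eq_adjoint, ← map_star, ← φ.map_star']
      simp only [star_mul, star_star, mul_assoc]
    simp only [h1] at hw
    change Tendsto (fun d => π (r d) (ε a k)) atTop (𝓝 0)
    rw [tendsto_zero_iff_norm_tendsto_zero]
    have h2 := (Complex.continuous_re.tendsto _).comp hw
    have h3 : Tendsto (fun d => ‖π (r d) (ε a k)‖ ^ 2) atTop (𝓝 0) := by
      refine h2.congr fun d => ?_
      simp [← Complex.ofReal_pow]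
    have h4 := (Real.continuous_sqrt.tendsto 0).comp h3
    rw [Real.sqrt_zero] at h4
    exact h4.congr fun d => Real.sqrt_sq (norm_nonneg _)
  intro z
  simp only [hsq]
  have h1 := (hmain z).norm
  rw [norm_zero] at h1
  have h2 := ((Complex.continuous_ofReal.tendsto 0).comp h1).pow 2
  simpa using h2

end IsStinespring

/-- A unital completely positive map is multiplicative on its multiplicative domain. -/
theorem CompletelyPositiveMap.map_star_mul_of_map_star_mul_self (σ : A →CP B)
    {l : B →⋆ₐ[ℂ] (K →L[ℂ] K)} (hl : Function.Injective l) (h1 : σ 1 = 1) {c : A}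
    (hc : σ (star c * c) = star (σ c) * σ c) (p : A) : σ (star c * p) = star (σ c) * σ p := by
  obtain ⟨H, _, _, _, ε, h⟩ := exists_isStinespring σ l
  -- Expanding the squared distance of c ⊗ k and 1 ⊗ σ(c)k, the hypothesis on σ(c⋆c) and σ(1) = 1
  -- make everything cancel. Pairing with p ⊗ k' then gives multiplicativity.
  have hV : ∀ k, ε c k = ε 1 (l (σ c) k) := by
    intro k
    rw [← sub_eq_zero, ← inner_self_eq_zero (𝕜 := ℂ)]
    simp only [inner_sub_left, inner_sub_right, h.inner_eq, hc, star_one, one_mul, mul_one, h1,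
      map_one, one_apply_eq_self, map_mul, mul_apply_eq_comp, σ.map_star', map_star,
      ContinuousLinearMap.star_eq_adjoint, ContinuousLinearMap.adjoint_inner_right]
    simp
  refine hl (ContinuousLinearMap.ext fun k => ext_inner_left ℂ fun k' => ?_)
  rw [← h.inner_eq, hV, h.inner_eq, star_one, one_mul, map_mul, map_star, mul_apply_eq_comp,
    ContinuousLinearMap.star_eq_adjoint, ContinuousLinearMap.adjoint_inner_right]

end Stinespring

/-! ### Bounded module maps -/

section BoundedModuleMaps

variable {B : Type*} [CStarAlgebra B] {X : Type*} [NormedAddCommGroup X] [NormedSpace ℂ X]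
  [Module Bᵐᵒᵖ X] [IsScalarTower ℂ Bᵐᵒᵖ X]

/-- Complex scalars act through B, so a module map is complex linear and has an operator norm. -/
theorem ContinuousLinearMap.exists_bound_of_isScalarTower {Y : Type*} [NormedAddCommGroup Y]
    [NormedSpace ℂ Y] [Module Bᵐᵒᵖ Y] [IsScalarTower ℂ Bᵐᵒᵖ Y] (T : X →L[Bᵐᵒᵖ] Y) :
    ∃ C : ℝ, 0 ≤ C ∧ ∀ z, ‖T z‖ ≤ C * ‖z‖ :=
  ⟨‖T.restrictScalars ℂ‖, norm_nonneg _, (T.restrictScalars ℂ).le_opNorm⟩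

instance isScalarTower_op_self : IsScalarTower ℂ Bᵐᵒᵖ B :=
  ⟨fun c b z => by
    induction b with
    | h b => rw [← op_smul, op_smul_eq_mul, op_smul_eq_mul, mul_smul_comm]⟩

namespace PreHilbertModule

variable [PartialOrder B] [PreHilbertModule B X]

theorem inner_sum_right {n : ℕ} (z : X) (f : Fin n → X) :
    inner B z (∑ i, f i) = ∑ i, inner B z (f i) :=
  map_sum (AddMonoidHom.mk' (fun t => inner B z t) (inner_add_right z)) f Finset.univ

theorem inner_sum_left {n : ℕ} (z : X) (f : Fin n → X) :
    inner B (∑ i, f i) z = ∑ i, inner B (f i) z :=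
  map_sum (AddMonoidHom.mk' (fun t => inner B t z) fun s t => inner_add_left s t z) f
    Finset.univ

end PreHilbertModule

end BoundedModuleMaps

/-! ### Self-dual modules of intertwiners -/

section Intertwiner

open scoped InnerProductSpace ComplexOrder

variable {B : Type*} [CStarAlgebra B]
  {K : Type*} [NormedAddCommGroup K] [InnerProductSpace ℂ K] [CompleteSpace K]
  {H : Type*} [NormedAddCommGroup H] [InnerProductSpace ℂ H]

/-- A relation between the commutant of `B` and operators on `H` that is closed under adjoints. -/
structure IsCommutantRelation [CompleteSpace H] (l : B →⋆ₐ[ℂ] (K →L[ℂ] K))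
    (G : Set ((K →L[ℂ] K) × (H →L[ℂ] H))) : Prop where
  commute : ∀ p ∈ G, ∀ b, Commute p.1 (l b)
  exists_mem : ∀ c, (∀ b, Commute c (l b)) → ∃ T, (c, T) ∈ G
  star_mem : ∀ p ∈ G, (star p.1, star p.2) ∈ G

/-- The operators `K → H` that intertwine all pairs in `G`. -/
def intertwiners (l : B →⋆ₐ[ℂ] (K →L[ℂ] K)) (G : Set ((K →L[ℂ] K) × (H →L[ℂ] H))) :
    Submodule ℂ (K →L[ℂ] H) where
  -- The commutation clause allows the right action of B to be defined for an arbitrary G; for a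
  -- commutant relation it holds automatically.
  carrier := {T | ∀ p ∈ G, (∀ b, Commute p.1 (l b)) → T ∘L p.1 = p.2 ∘L T}
  add_mem' := fun {S T} hS hT p hp hc => by
    rw [ContinuousLinearMap.add_comp, ContinuousLinearMap.comp_add, hS p hp hc, hT p hp hc]
  zero_mem' := fun p _ _ => by
    rw [ContinuousLinearMap.zero_comp, ContinuousLinearMap.comp_zero]
  smul_mem' := fun c T hT p hp hc => by
    rw [ContinuousLinearMap.smul_comp, ContinuousLinearMap.comp_smul, hT p hp hc]

/-- The right `B`-module of operators `K → H` that intertwine all pairs in `G`. -/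
def Intertwiner (l : B →⋆ₐ[ℂ] (K →L[ℂ] K)) (G : Set ((K →L[ℂ] K) × (H →L[ℂ] H))) :=
  ↥(intertwiners l G)

namespace Intertwiner

variable {l : B →⋆ₐ[ℂ] (K →L[ℂ] K)} {G : Set ((K →L[ℂ] K) × (H →L[ℂ] H))}

noncomputable instance : NormedAddCommGroup (Intertwiner l G) :=
  inferInstanceAs (NormedAddCommGroup ↥(intertwiners l G))

noncomputable instance : NormedSpace ℂ (Intertwiner l G) :=
  inferInstanceAs (NormedSpace ℂ ↥(intertwiners l G))

instance [CompleteSpace H] : CompleteSpace (Intertwiner l G) := by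
  have : IsClosed (intertwiners l G : Set (K →L[ℂ] H)) := by
    have h : (intertwiners l G : Set (K →L[ℂ] H))
        = ⋂ p ∈ G, ⋂ (_ : ∀ b, Commute p.1 (l b)), {T | T ∘L p.1 = p.2 ∘L T} := by
      ext T
      simp [intertwiners]
    rw [h]
    refine isClosed_biInter fun p _ => isClosed_iInter fun _ => isClosed_eq ?_ ?_ <;> fun_prop
  exact this.completeSpace_coe

/-- The underlying operator. -/
def toCLM : Intertwiner l G →ₗ[ℂ] K →L[ℂ] H := (intertwiners l G).subtype

theorem toCLM_injective : Function.Injective (toCLM : Intertwiner l G → K →L[ℂ] H) :=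
  Subtype.val_injective

theorem norm_toCLM (z : Intertwiner l G) : ‖z.toCLM‖ = ‖z‖ := rfl

/-- Intertwiners, from operators that intertwine `G`. -/
def mk (T : K →L[ℂ] H) (hT : ∀ p ∈ G, ∀ k, T (p.1 k) = p.2 (T k)) : Intertwiner l G :=
  ⟨T, fun p hp _ => ContinuousLinearMap.ext fun k => hT p hp k⟩

@[simp]
theorem toCLM_mk (T : K →L[ℂ] H) (hT) : (mk T hT : Intertwiner l G).toCLM = T := rfl

noncomputable instance : SMul Bᵐᵒᵖ (Intertwiner l G) where
  smul b z := ⟨z.toCLM ∘L l b.unop, fun p hp hc => by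
    rw [ContinuousLinearMap.comp_assoc]
    change z.toCLM ∘L (l b.unop * p.1) = _
    rw [← (hc b.unop).eq, ← ContinuousLinearMap.comp_assoc]
    exact congrArg (fun T : K →L[ℂ] H => T ∘L l b.unop) (z.2 p hp hc)⟩

theorem toCLM_op_smul (b : B) (z : Intertwiner l G) : (op b • z).toCLM = z.toCLM ∘L l b := rfl

theorem toCLM_op_smul_apply (b : B) (z : Intertwiner l G) (k : K) :
    (op b • z).toCLM k = z.toCLM (l b k) := rfl

theorem toCLM_smul' (b : Bᵐᵒᵖ) (z : Intertwiner l G) :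
    (b • z).toCLM = z.toCLM ∘L l b.unop := rfl

noncomputable instance : Module Bᵐᵒᵖ (Intertwiner l G) where
  one_smul z := toCLM_injective <| by
    rw [toCLM_smul', unop_one, map_one]
    rfl
  mul_smul b c z := toCLM_injective <| by
    rw [toCLM_smul', toCLM_smul', toCLM_smul', unop_mul, map_mul]
    rfl
  smul_zero b := toCLM_injective <| by
    rw [toCLM_smul', map_zero, ContinuousLinearMap.zero_comp]
  smul_add b z z' := toCLM_injective <| by
    rw [toCLM_smul', map_add, map_add, toCLM_smul', toCLM_smul', ContinuousLinearMap.add_comp]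
  add_smul b c z := toCLM_injective <| by
    rw [toCLM_smul', map_add, toCLM_smul', toCLM_smul', unop_add, map_add,
      ContinuousLinearMap.comp_add]
  zero_smul z := toCLM_injective <| by
    rw [toCLM_smul', unop_zero, map_zero, map_zero, ContinuousLinearMap.comp_zero]

instance : IsScalarTower ℂ Bᵐᵒᵖ (Intertwiner l G) where
  smul_assoc c b z := toCLM_injective <| by
    rw [toCLM_smul', unop_smul, map_smul, map_smul, toCLM_smul', ContinuousLinearMap.comp_smul]

variable [CompleteSpace H] [hG : Fact (IsCommutantRelation l G)]

theorem toCLM_apply_map (z : Intertwiner l G) {p : (K →L[ℂ] K) × (H →L[ℂ] H)} (hp : p ∈ G)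
    (k : K) : z.toCLM (p.1 k) = p.2 (z.toCLM k) :=
  DFunLike.congr_fun (z.2 p hp (hG.out.commute p hp)) k

variable [hl : Fact (IsVNRep l)]

/-- Since G is closed under adjoints, z⋆ intertwines in the opposite direction. Hence z⋆z' commutes
with l(B)', and the double commutant property applies. -/
theorem exists_eq_adjoint_comp (z z' : Intertwiner l G) :
    ∃ b, l b = ContinuousLinearMap.adjoint z.toCLM ∘L z'.toCLM := by
  refine hl.out.exists_eq _ fun c hc => ?_
  obtain ⟨T, hT⟩ := hG.out.exists_mem c hc
  refine ContinuousLinearMap.ext fun k => ext_inner_left ℂ fun k' => ?_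
  change ⟪k', c (ContinuousLinearMap.adjoint z.toCLM (z'.toCLM k))⟫_ℂ
    = ⟪k', ContinuousLinearMap.adjoint z.toCLM (z'.toCLM (c k))⟫_ℂ
  have h1 := z.toCLM_apply_map (hG.out.star_mem _ hT) k'
  have h2 := z'.toCLM_apply_map hT k
  dsimp only at h1 h2
  rw [ContinuousLinearMap.adjoint_inner_right, h2, ← ContinuousLinearMap.adjoint_inner_left,
    ContinuousLinearMap.adjoint_inner_right, ← ContinuousLinearMap.star_eq_adjoint, h1,
    ContinuousLinearMap.star_eq_adjoint, ContinuousLinearMap.adjoint_inner_left]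

noncomputable instance : Inner B (Intertwiner l G) where
  inner z z' := Classical.choose (exists_eq_adjoint_comp z z')

theorem map_inner (z z' : Intertwiner l G) :
    l (inner B z z') = ContinuousLinearMap.adjoint z.toCLM ∘L z'.toCLM :=
  Classical.choose_spec (exists_eq_adjoint_comp z z')

theorem inner_toCLM (z z' : Intertwiner l G) (k k' : K) :
    ⟪z.toCLM k, z'.toCLM k'⟫_ℂ = ⟪k, l (inner B z z') k'⟫_ℂ := by
  rw [map_inner, ContinuousLinearMap.comp_apply, ContinuousLinearMap.adjoint_inner_right]

/-- The norm of `∑ᵢ xᵢ kᵢ`. -/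
theorem norm_sq_sum {n : ℕ} (x : Fin n → Intertwiner l G) (k : Fin n → K) :
    ‖∑ i, (x i).toCLM (k i)‖ ^ 2
      = (∑ i, ∑ j, ⟪k i, l (inner B (x i) (x j)) (k j)⟫_ℂ).re := by
  rw [← inner_self_eq_norm_sq (𝕜 := ℂ)]
  simp only [_root_.inner_sum, _root_.sum_inner, inner_toCLM]
  rw [Finset.sum_comm]
  rfl

variable [PartialOrder B] [StarOrderedRing B]

noncomputable instance : PreHilbertModule B (Intertwiner l G) where
  inner_add_right z z₁ z₂ := hl.out.injective <| by
    rw [map_add, map_inner, map_inner, map_inner, map_add, ContinuousLinearMap.comp_add]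
  inner_op_smul_right z z' b := hl.out.injective <| by
    rw [map_mul, map_inner, map_inner, toCLM_op_smul, ← ContinuousLinearMap.comp_assoc]
    rfl
  inner_self_nonneg z := nonneg_of_forall_inner hl.out.injective fun k => by
    rw [map_inner, ContinuousLinearMap.comp_apply, ContinuousLinearMap.adjoint_inner_left,
      inner_self_eq_norm_sq_to_K]
    positivity
  inner_self_eq_zero z := by
    rw [← map_eq_zero_iff l hl.out.injective, map_inner, ← norm_eq_zero,
      ContinuousLinearMap.norm_adjoint_comp_self, mul_self_eq_zero, norm_toCLM, norm_eq_zero]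
  star_inner z z' := hl.out.injective <| by
    rw [map_star, map_inner, map_inner, ContinuousLinearMap.star_eq_adjoint,
      ContinuousLinearMap.adjoint_comp, ContinuousLinearMap.adjoint_adjoint]
  norm_eq_sqrt z := by
    rw [← NonUnitalStarAlgHom.norm_map l hl.out.injective, map_inner,
      ContinuousLinearMap.norm_adjoint_comp_self, norm_toCLM, Real.sqrt_mul_self (norm_nonneg _)]

theorem eq_of_forall_inner {ι : Type*} {x : ι → Intertwiner l G}
    (hx : IsTotalFamily fun i => (x i).toCLM) {z z' : Intertwiner l G}
    (h : ∀ i, inner B z (x i) = inner B z' (x i)) : z = z' := by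
  refine toCLM_injective (ContinuousLinearMap.ext fun k => hx.eq_of_forall_inner fun i k' => ?_)
  rw [inner_toCLM, inner_toCLM, ← PreHilbertModule.star_inner z, h, PreHilbertModule.star_inner]

/-- The hypothesis tests only coefficients in B, the conclusion vectors of K. The bridge is
positivity over B of the matrix C²⟨xᵢ, xⱼ⟩ − gᵢ⋆gⱼ, whose quadratic form on K is the desired
difference of squares. -/
theorem norm_sum_map_le {n : ℕ} (x : Fin n → Intertwiner l G) (g : Fin n → B) {C : ℝ}
    (hC : 0 ≤ C) (h : ∀ b : Fin n → B, ‖∑ i, g i * b i‖ ≤ C * ‖∑ i, op (b i) • x i‖)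
    (k : Fin n → K) : ‖∑ i, l (g i) (k i)‖ ≤ C * ‖∑ i, (x i).toCLM (k i)‖ := by
  set M : CStarMatrix (Fin n) (Fin n) B := CStarMatrix.ofMatrix (Matrix.of fun i j =>
    ((C ^ 2 : ℝ) : ℂ) • inner B (x i) (x j) - star (g i) * g j) with hM
  have hMij : ∀ i j, M i j = ((C ^ 2 : ℝ) : ℂ) • inner B (x i) (x j) - star (g i) * g j :=
    fun i j => rfl
  have hM0 : 0 ≤ M := by
    refine CStarMatrix.nonneg_of_forall_sum_nonneg ?_ fun b => ?_
    · ext i j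
      rw [CStarMatrix.star_apply, hMij, hMij, star_sub, star_smul, star_mul, star_star,
        PreHilbertModule.star_inner, RCLike.star_def, Complex.conj_ofReal]
    · set z := ∑ i, op (b i) • x i with hz
      set w := ∑ i, g i * b i with hw
      have h1 : ∑ i, ∑ j, star (b i) * M i j * b j
          = ((C ^ 2 : ℝ) : ℂ) • inner B z z - star w * w := by
        rw [hw, star_sum_mul_sum, hz, PreHilbertModule.inner_sum_left, Finset.smul_sum,
          ← Finset.sum_sub_distrib]
        refine Finset.sum_congr rfl fun i _ => ?_
        rw [PreHilbertModule.inner_sum_right, Finset.smul_sum, ← Finset.sum_sub_distrib]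
        refine Finset.sum_congr rfl fun j _ => ?_
        rw [hMij, PreHilbertModule.inner_op_smul_left, PreHilbertModule.inner_op_smul_right,
          mul_sub, sub_mul, star_mul, mul_smul_comm, smul_mul_assoc]
        simp only [mul_assoc]
      rw [h1, sub_nonneg, Complex.coe_smul]
      -- The norm bound becomes the order bound w⋆w ≤ C²⟨z, z⟩ because it remains valid after
      -- replacing every bᵢ by bᵢc, which conjugates both sides by c.
      refine le_smul_of_forall_norm_conjugate_le (star_mul_self_nonneg w)
        (PreHilbertModule.inner_self_nonneg z) (by positivity) fun c => ?_
      have h2 := h fun i => b i * c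
      have h3 : ∑ i, g i * (b i * c) = w * c := by
        rw [hw, Finset.sum_mul]
        simp only [mul_assoc]
      have h4 : ∑ i, op (b i * c) • x i = op c • z := by
        rw [hz, Finset.smul_sum]
        simp only [op_mul, mul_smul]
      rw [h3, h4] at h2
      have h5 : star c * (star w * w) * c = star (w * c) * (w * c) := by
        rw [star_mul]
        simp only [mul_assoc]
      have h6 : star c * inner B z z * c = inner B (op c • z) (op c • z) := by
        rw [PreHilbertModule.inner_op_smul_left, PreHilbertModule.inner_op_smul_right,
          mul_assoc]
      rw [h5, h6, CStarRing.norm_star_mul_self, ← PreHilbertModule.norm_sq, ← pow_two,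
        ← mul_pow]
      gcongr
  have h1 := (RCLike.nonneg_iff.1 (CStarMatrix.sum_inner_map_nonneg hM0 l k)).1
  have h2 : RCLike.re (∑ i, ∑ j, ⟪k i, l (M i j) (k j)⟫_ℂ)
      = C ^ 2 * ‖∑ i, (x i).toCLM (k i)‖ ^ 2 - ‖∑ i, l (g i) (k i)‖ ^ 2 := by
    rw [norm_sq_sum, ← inner_self_eq_norm_sq (𝕜 := ℂ) (∑ i, l (g i) (k i)),
      ← Complex.re_ofReal_mul]
    change _ = _ - (⟪∑ i, l (g i) (k i), ∑ i, l (g i) (k i)⟫_ℂ).re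
    rw [← Complex.sub_re]
    change Complex.re _ = _
    congr 1
    rw [_root_.sum_inner, Finset.mul_sum, ← Finset.sum_sub_distrib]
    refine Finset.sum_congr rfl fun i _ => ?_
    rw [_root_.inner_sum, Finset.mul_sum, ← Finset.sum_sub_distrib]
    refine Finset.sum_congr rfl fun j _ => ?_
    rw [hMij, map_sub, map_smul, map_mul, map_star, sub_apply, smul_apply, inner_sub_right,
      inner_smul_right, mul_apply_eq_comp, ContinuousLinearMap.star_eq_adjoint,
      ContinuousLinearMap.adjoint_inner_right]
  rw [h2, ← mul_pow] at h1
  exact (pow_le_pow_iff_left₀ (norm_nonneg _) (by positivity) two_ne_zero).1 (by linarith)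

/-- Bounded `B`-valued maps on a total family are represented by intertwiners. -/
theorem exists_inner_eq {ι : Type*} {x : ι → Intertwiner l G}
    (hx : IsTotalFamily fun i => (x i).toCLM) (g : ι → B) {C : ℝ} (hC : 0 ≤ C)
    (h : ∀ (n : ℕ) (i : Fin n → ι) (b : Fin n → B),
      ‖∑ m, g (i m) * b m‖ ≤ C * ‖∑ m, op (b m) • x (i m)‖) :
    ∃ z : Intertwiner l G, ‖z‖ ≤ C ∧ ∀ i, inner B z (x i) = g i := by
  -- T sends xᵢk to l(gᵢ)k. Its adjoint represents g, because (T⋆)⋆xᵢ = Txᵢ = l(gᵢ); it remains to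
  -- see that T⋆ is an intertwiner.
  obtain ⟨T, hTC, hT⟩ := hx.exists_extension (fun i => l (g i)) hC fun n i k =>
    norm_sum_map_le (fun m => x (i m)) (fun m => g (i m)) hC (h n i) k
  have hz : ∀ p ∈ G, ∀ k, ContinuousLinearMap.adjoint T (p.1 k)
      = p.2 (ContinuousLinearMap.adjoint T k) := by
    intro p hp k
    have hs := hG.out.star_mem p hp
    refine hx.eq_of_forall_inner fun i k' => ?_
    rw [ContinuousLinearMap.adjoint_inner_right, hT, ← ContinuousLinearMap.adjoint_inner_left,
      ← ContinuousLinearMap.adjoint_inner_left p.2, ContinuousLinearMap.adjoint_inner_right T,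
      ← ContinuousLinearMap.star_eq_adjoint, ← ContinuousLinearMap.star_eq_adjoint,
      ← (x i).toCLM_apply_map hs, hT]
    exact congrArg (fun t => ⟪t, k⟫_ℂ) (DFunLike.congr_fun (hG.out.commute _ hs (g i)).eq k')
  refine ⟨mk (ContinuousLinearMap.adjoint T) hz, ?_, fun i => hl.out.injective ?_⟩
  · rwa [← norm_toCLM, toCLM_mk, LinearIsometryEquiv.norm_map]
  · rw [map_inner, toCLM_mk, ContinuousLinearMap.adjoint_adjoint]
    exact ContinuousLinearMap.ext fun k => hT i k

/-- Bounded module maps on submodules with total range are represented by intertwiners. -/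
theorem existsUnique_inner_eq (X₀ : Submodule Bᵐᵒᵖ (Intertwiner l G))
    (hX₀ : IsTotalFamily fun z : X₀ => (z : Intertwiner l G).toCLM) (τ : X₀ →L[Bᵐᵒᵖ] B) :
    ∃! z : Intertwiner l G, ∀ z' : X₀, τ z' = inner B z (z' : Intertwiner l G) := by
  obtain ⟨C, hC, hτ⟩ := τ.exists_bound_of_isScalarTower
  obtain ⟨z, -, hz⟩ := exists_inner_eq hX₀ τ hC fun n i b => by
    have h1 : ∑ m, τ (i m) * b m = τ (∑ m, op (b m) • i m) := by
      simp only [map_sum, map_smul, op_smul_eq_mul]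
    rw [h1]
    refine (hτ _).trans_eq ?_
    rw [← Submodule.norm_coe, Submodule.coe_sum]
    rfl
  exact ⟨z, fun z' => (hz z').symm, fun z' hz' =>
    eq_of_forall_inner hX₀ fun i => by rw [hz, hz']⟩

theorem isSelfDual (hX : IsTotalFamily fun z : Intertwiner l G => z.toCLM) :
    IsSelfDual B (Intertwiner l G) := by
  intro τ
  obtain ⟨C, hC, hτ⟩ := τ.exists_bound_of_isScalarTower
  obtain ⟨z, -, hz⟩ := exists_inner_eq (x := fun z : Intertwiner l G => z) hX τ hC
    fun n i b => by
      have h1 : ∑ m, τ (i m) * b m = τ (∑ m, op (b m) • i m) := by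
        simp only [map_sum, map_smul, op_smul_eq_mul]
      rw [h1]
      exact hτ _
  exact ⟨z, fun z' => (hz z').symm⟩

/-- Bounded maps on a total family into a self-dual module extend uniquely to bounded module
maps. -/
theorem existsUnique_lift {ι : Type*} {x : ι → Intertwiner l G}
    (hx : IsTotalFamily fun i => (x i).toCLM)
    {Y : Type*} [NormedAddCommGroup Y] [NormedSpace ℂ Y] [Module Bᵐᵒᵖ Y]
    [IsScalarTower ℂ Bᵐᵒᵖ Y] [PreHilbertModule B Y] (hY : IsSelfDual B Y) (g : ι → Y) {C : ℝ}
    (hC : 0 ≤ C)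
    (h : ∀ (n : ℕ) (i : Fin n → ι) (b : Fin n → B),
      ‖∑ m, op (b m) • g (i m)‖ ≤ C * ‖∑ m, op (b m) • x (i m)‖) :
    ∃! T : Intertwiner l G →L[Bᵐᵒᵖ] Y, ∀ i, T (x i) = g i := by
  have hX : IsTotalFamily fun z : Intertwiner l G => z.toCLM := hx.mono x fun _ _ => rfl
  -- The adjoint S of the desired map is built first: S y represents xᵢ ↦ ⟨y, gᵢ⟩. Self-duality of Y
  -- then yields T as the adjoint of S.
  have hS : ∀ y : Y, ∃ z : Intertwiner l G, ‖z‖ ≤ C * ‖y‖ ∧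
      ∀ i, inner B z (x i) = inner B y (g i) := fun y =>
    exists_inner_eq hx (fun i => inner B y (g i)) (by positivity) fun n i b => by
      have h1 : ∑ m, inner B y (g (i m)) * b m = inner B y (∑ m, op (b m) • g (i m)) := by
        simp only [PreHilbertModule.inner_sum_right, PreHilbertModule.inner_op_smul_right]
      rw [h1]
      calc _ ≤ ‖y‖ * ‖∑ m, op (b m) • g (i m)‖ := PreHilbertModule.norm_inner_le _ _
        _ ≤ ‖y‖ * (C * ‖∑ m, op (b m) • x (i m)‖) := by gcongr; exact h n i b
        _ = _ := by ring
  choose S hSC hS using hS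
  have hSadd : ∀ y y', S (y + y') = S y + S y' := fun y y' => eq_of_forall_inner hx fun i => by
    rw [hS, PreHilbertModule.inner_add_left, PreHilbertModule.inner_add_left, hS, hS]
  have hSsmul : ∀ (b : Bᵐᵒᵖ) y, S (b • y) = b • S y := by
    intro b y
    induction b with
    | h b =>
      refine eq_of_forall_inner hx fun i => ?_
      rw [hS, PreHilbertModule.inner_op_smul_left, PreHilbertModule.inner_op_smul_left, hS]
  have hT : ∀ z : Intertwiner l G, ∃ t : Y, ∀ y, inner B t y = inner B z (S y) := by
    intro z
    obtain ⟨t, ht⟩ := hY (LinearMap.mkContinuous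
      { toFun := fun y => inner B z (S y)
        map_add' := fun y y' => by rw [hSadd, PreHilbertModule.inner_add_right]
        map_smul' := fun b y => by
          induction b with
          | h b => rw [hSsmul, PreHilbertModule.inner_op_smul_right]; rfl }
      (‖z‖ * C) fun y => (PreHilbertModule.norm_inner_le z (S y)).trans (by
        rw [mul_assoc]
        gcongr
        exact hSC y))
    exact ⟨t, fun y => (ht y).symm⟩
  choose T hT using hT
  have hTi : ∀ i, T (x i) = g i := fun i => PreHilbertModule.eq_of_inner_left (B := B) fun y => by
    rw [hT, ← PreHilbertModule.star_inner, hS, PreHilbertModule.star_inner]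
  refine ⟨LinearMap.mkContinuous
    { toFun := T
      map_add' := fun z z' => PreHilbertModule.eq_of_inner_left (B := B) fun y => by
        rw [hT, PreHilbertModule.inner_add_left, PreHilbertModule.inner_add_left, hT, hT]
      map_smul' := fun b z => PreHilbertModule.eq_of_inner_left (B := B) fun y => by
        induction b with
        | h b =>
          rw [hT, RingHom.id_apply, PreHilbertModule.inner_op_smul_left,
            PreHilbertModule.inner_op_smul_left, hT] } C fun z => ?_, hTi, fun T' hT' => ?_⟩
  · change ‖T z‖ ≤ C * ‖z‖
    rcases (norm_nonneg (T z)).eq_or_lt with h0 | h0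
    · rw [← h0]
      positivity
    · refine le_of_mul_le_mul_right ?_ h0
      calc ‖T z‖ * ‖T z‖ = ‖inner B z (S (T z))‖ := by
            rw [← pow_two, PreHilbertModule.norm_sq (B := B), hT]
        _ ≤ ‖z‖ * ‖S (T z)‖ := PreHilbertModule.norm_inner_le _ _
        _ ≤ ‖z‖ * (C * ‖T z‖) := by gcongr; exact hSC _
        _ = C * ‖z‖ * ‖T z‖ := by ring
  -- The xᵢ need not span a norm-dense submodule, so uniqueness goes through adjoints: by
  -- self-duality z ↦ ⟨y, T'z⟩ is represented by an element, and its values on the xᵢ identify that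
  -- element as S y.
  · obtain ⟨C', hC', hbound⟩ := T'.exists_bound_of_isScalarTower
    ext z
    change T' z = T z
    refine PreHilbertModule.eq_of_inner_left (B := B) fun y => ?_
    rw [← PreHilbertModule.star_inner, hT, ← PreHilbertModule.star_inner (S y)]
    congr 1
    obtain ⟨t, ht⟩ := isSelfDual hX (LinearMap.mkContinuous
      { toFun := fun z => inner B y (T' z)
        map_add' := fun z z' => by rw [map_add, PreHilbertModule.inner_add_right]
        map_smul' := fun b z => by
          induction b with
          | h b => rw [map_smul, PreHilbertModule.inner_op_smul_right]; rfl }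
      (‖y‖ * C') fun z => (PreHilbertModule.norm_inner_le y (T' z)).trans (by
        rw [mul_assoc]
        gcongr
        exact hbound z))
    have ht' : ∀ z, inner B y (T' z) = inner B t z := ht
    have : t = S y := eq_of_forall_inner hx fun i => by rw [← ht', hT', hS]
    rw [ht', this]

end Intertwiner

end Intertwiner

/-! ### The adjointable operators on a module of intertwiners -/

section IntertwinerOperators

open scoped InnerProductSpace ComplexOrder

namespace Intertwiner

variable {B : Type*} [CStarAlgebra B]
  {K : Type*} [NormedAddCommGroup K] [InnerProductSpace ℂ K] [CompleteSpace K]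
  {H : Type*} [NormedAddCommGroup H] [InnerProductSpace ℂ H] [CompleteSpace H]
  {l : B →⋆ₐ[ℂ] (K →L[ℂ] K)} {G : Set ((K →L[ℂ] K) × (H →L[ℂ] H))}
  [hG : Fact (IsCommutantRelation l G)]

/-- The von Neumann algebra of the operators on `H` that commute with the second components of
`G`. -/
noncomputable def endVN (G : Set ((K →L[ℂ] K) × (H →L[ℂ] H))) : VonNeumannAlgebra H where
  toStarSubalgebra := StarSubalgebra.centralizer ℂ (Prod.snd '' G)
  centralizer_centralizer' := by
    have h : (StarSubalgebra.centralizer ℂ (Prod.snd '' G)).carrier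
        = (Prod.snd '' G ∪ star (Prod.snd '' G)).centralizer :=
      StarSubalgebra.coe_centralizer ℂ _
    rw [h, Set.centralizer_centralizer_centralizer]

theorem mem_endVN_iff (l : B →⋆ₐ[ℂ] (K →L[ℂ] K)) [hG : Fact (IsCommutantRelation l G)]
    {T : H →L[ℂ] H} :
    T ∈ (endVN G).toStarSubalgebra ↔ ∀ p ∈ G, ∀ z, T (p.2 z) = p.2 (T z) := by
  change T ∈ StarSubalgebra.centralizer ℂ (Prod.snd '' G) ↔ _
  rw [StarSubalgebra.mem_centralizer_iff]
  constructor
  · intro h p hp z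
    exact (DFunLike.congr_fun (h p.2 ⟨p, hp, rfl⟩).1 z).symm
  -- The centralizer also asks for commutation with adjoints, which closure of G under adjoints
  -- supplies.
  · rintro h _ ⟨p, hp, rfl⟩
    exact ⟨(ContinuousLinearMap.ext (h p hp)).symm,
      (ContinuousLinearMap.ext (h _ (hG.out.star_mem p hp))).symm⟩

/-- An operator in `endVN G` acts on intertwiners. -/
noncomputable def lmulCLM (T : (endVN G).toStarSubalgebra) :
    Intertwiner l G →L[ℂ] Intertwiner l G :=
  LinearMap.mkContinuous
    { toFun := fun z => mk ((T : H →L[ℂ] H) ∘L z.toCLM) fun p hp k => by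
        rw [ContinuousLinearMap.comp_apply, ContinuousLinearMap.comp_apply,
          z.toCLM_apply_map hp, (mem_endVN_iff l).1 T.2 p hp]
      map_add' := fun z z' => toCLM_injective <|
        ContinuousLinearMap.ext fun k => map_add (T : H →L[ℂ] H) (z.toCLM k) (z'.toCLM k)
      map_smul' := fun c z => toCLM_injective <|
        ContinuousLinearMap.ext fun k => map_smul (T : H →L[ℂ] H) c (z.toCLM k) }
    ‖(T : H →L[ℂ] H)‖ fun z => by
    change ‖(T : H →L[ℂ] H) ∘L z.toCLM‖ ≤ _
    exact ContinuousLinearMap.opNorm_comp_le _ _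

theorem toCLM_lmulCLM (T : (endVN G).toStarSubalgebra) (z : Intertwiner l G) (k : K) :
    (lmulCLM T z).toCLM k = (T : H →L[ℂ] H) (z.toCLM k) := rfl

variable [hl : Fact (IsVNRep l)]

theorem inner_lmulCLM (T : (endVN G).toStarSubalgebra) (z z' : Intertwiner l G) :
    inner B (lmulCLM T z) z' = inner B z (lmulCLM (star T) z') := by
  refine hl.out.injective (ContinuousLinearMap.ext fun k => ext_inner_left ℂ fun k' => ?_)
  rw [← inner_toCLM, ← inner_toCLM, toCLM_lmulCLM, toCLM_lmulCLM]
  exact (ContinuousLinearMap.adjoint_inner_right _ _ _).symm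

variable [PartialOrder B] [StarOrderedRing B]

/-- The operators in `endVN G` act by adjointable operators. -/
noncomputable def lmulOp (T : (endVN G).toStarSubalgebra) :
    AdjointableOperator B (Intertwiner l G) :=
  ⟨lmulCLM T, lmulCLM (star T), inner_lmulCLM T⟩

theorem star_lmulOp (T : (endVN G).toStarSubalgebra) :
    star (lmulOp T : AdjointableOperator B (Intertwiner l G)) = lmulOp (star T) :=
  AdjointableOperator.toCLM_injective <| by
    rw [AdjointableOperator.toCLM_star]
    refine AdjointableOperator.adj_eq_of _ _ fun z z' => ?_
    have := inner_lmulCLM (star T) z z'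
    rw [star_star] at this
    exact this

/-- The representation of `endVN G` by adjointable operators. -/
noncomputable def lmul :
    (endVN G).toStarSubalgebra →⋆ₐ[ℂ] AdjointableOperator B (Intertwiner l G) where
  toFun T := lmulOp T
  map_one' := AdjointableOperator.toCLM_injective rfl
  map_mul' _ _ := AdjointableOperator.toCLM_injective rfl
  map_zero' := AdjointableOperator.toCLM_injective rfl
  map_add' _ _ := AdjointableOperator.toCLM_injective rfl
  commutes' _ := AdjointableOperator.toCLM_injective rfl
  map_star' T := (star_lmulOp T).symm

theorem toCLM_lmul (T : (endVN G).toStarSubalgebra) (z : Intertwiner l G) (k : K) :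
    (lmul T z).toCLM k = (T : H →L[ℂ] H) (z.toCLM k) := rfl

/-- The defect argument again, now in the C⋆-algebra of adjointable operators: ‖T‖² − T⋆T = c⋆c. It
makes zk ↦ (Tz)k a well-defined bounded operator on H. -/
theorem norm_sum_adjointable_le (T : AdjointableOperator B (Intertwiner l G)) {n : ℕ}
    (x : Fin n → Intertwiner l G) (k : Fin n → K) :
    ‖∑ i, (T (x i)).toCLM (k i)‖ ≤ ‖T‖ * ‖∑ i, (x i).toCLM (k i)‖ := by
  obtain ⟨c, hc⟩ := exists_star_mul_self_of_nonneg
    (sub_nonneg.2 (CStarAlgebra.star_mul_le_algebraMap_norm_sq (a := T)))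
  have hform : ∀ S : AdjointableOperator B (Intertwiner l G),
      ‖∑ i, (S (x i)).toCLM (k i)‖ ^ 2
        = (∑ i, ∑ j, ⟪k i, l (inner B (x i) ((star S * S) (x j))) (k j)⟫_ℂ).re := by
    intro S
    rw [norm_sq_sum]
    congr 1
    refine Finset.sum_congr rfl fun i _ => Finset.sum_congr rfl fun j _ => ?_
    rw [AdjointableOperator.inner_adj_right]
    rfl
  have key : ‖∑ i, (c (x i)).toCLM (k i)‖ ^ 2
      = ‖T‖ ^ 2 * ‖∑ i, (x i).toCLM (k i)‖ ^ 2 - ‖∑ i, (T (x i)).toCLM (k i)‖ ^ 2 := by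
    rw [hform, hform, norm_sq_sum, ← hc, ← Complex.re_ofReal_mul, ← Complex.sub_re]
    congr 1
    simp only [Finset.mul_sum, ← Finset.sum_sub_distrib]
    refine Finset.sum_congr rfl fun i _ => Finset.sum_congr rfl fun j _ => ?_
    have h1 : (algebraMap ℝ (AdjointableOperator B (Intertwiner l G)) (‖T‖ ^ 2) - star T * T)
        (x j) = ((‖T‖ ^ 2 : ℝ) : ℂ) • x j - (star T * T) (x j) := by
      rw [Algebra.algebraMap_eq_smul_one, ← Complex.coe_smul]
      rfl
    rw [h1, PreHilbertModule.inner_sub_right, PreHilbertModule.inner_smul_right, map_sub,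
      map_smul, sub_apply, smul_apply, _root_.inner_sub_right, _root_.inner_smul_right]
  have h0 := sq_nonneg ‖∑ i, (c (x i)).toCLM (k i)‖
  rw [key, ← mul_pow] at h0
  exact (pow_le_pow_iff_left₀ (norm_nonneg _) (by positivity) two_ne_zero).1 (by linarith)

/-- Injectivity is totality of the vectors zk. For surjectivity, the operator zk ↦ (Tz)k commutes
with 1 ⊗ c because (1 ⊗ c)zk = z(ck) and T z is again an intertwiner. -/
theorem lmul_bijective (hX : IsTotalFamily fun z : Intertwiner l G => z.toCLM) :
    Function.Bijective (lmul (l := l) (G := G)) := by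
  constructor
  · intro S T hST
    refine Subtype.ext (hX.clm_ext fun z k => ?_)
    rw [← toCLM_lmul, hST, toCLM_lmul]
  · intro T
    obtain ⟨T', -, hT'⟩ := hX.exists_extension (fun z => (T z).toCLM) (norm_nonneg T)
      fun n i k => norm_sum_adjointable_le T i k
    have hmem : T' ∈ (endVN G).toStarSubalgebra := by
      rw [mem_endVN_iff l]
      intro p hp
      have : T' ∘L p.2 = p.2 ∘L T' := hX.clm_ext fun z k => by
        rw [ContinuousLinearMap.comp_apply, ContinuousLinearMap.comp_apply,
          ← z.toCLM_apply_map hp, hT', hT', (T z).toCLM_apply_map hp]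
      exact fun z => DFunLike.congr_fun this z
    refine ⟨⟨T', hmem⟩, AdjointableOperator.toCLM_injective (ContinuousLinearMap.ext fun z =>
      toCLM_injective (ContinuousLinearMap.ext fun k => ?_))⟩
    exact hT' z k

/-- `B^a(X)` is represented on `H` as the von Neumann algebra `endVN G`. -/
theorem exists_rep_adjointable (hX : IsTotalFamily fun z : Intertwiner l G => z.toCLM) :
    ∃ θ : AdjointableOperator B (Intertwiner l G) →⋆ₐ[ℂ] (H →L[ℂ] H), IsVNRep θ ∧
      (∀ T z k, θ T (z.toCLM k) = (T z).toCLM k) ∧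
      ∀ S : H →L[ℂ] H, (∀ p ∈ G, ∀ z, S (p.2 z) = p.2 (S z)) → ∃ T, θ T = S := by
  let e := (StarAlgEquiv.ofBijective _ (lmul_bijective hX)).symm
  have he : ∀ T, lmul (e T) = T := fun T =>
    (StarAlgEquiv.ofBijective _ (lmul_bijective hX)).apply_symm_apply T
  have he' : ∀ T, e (lmul T) = T := fun T =>
    (StarAlgEquiv.ofBijective _ (lmul_bijective hX)).symm_apply_apply T
  refine ⟨_, isVNRep_of_equiv (endVN G) e, fun T z k => ?_, fun S hS =>
    ⟨lmul ⟨S, (mem_endVN_iff l).2 hS⟩, ?_⟩⟩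
  · nth_rw 2 [← he T]
    rfl
  · change ((e (lmul _) : (endVN G).toStarSubalgebra) : H →L[ℂ] H) = S
    rw [he']

/-- The universe levels are fixed so that H lives in the universe of the operator algebra, as
`IsVonNeumannAlgebra` demands. -/
theorem isVonNeumannAlgebra_adjointable {B : Type w} [CStarAlgebra B] [PartialOrder B]
    [StarOrderedRing B] {K : Type v} [NormedAddCommGroup K] [InnerProductSpace ℂ K]
    [CompleteSpace K] {H : Type (max u v)} [NormedAddCommGroup H] [InnerProductSpace ℂ H]
    [CompleteSpace H] {l : B →⋆ₐ[ℂ] (K →L[ℂ] K)} {G : Set ((K →L[ℂ] K) × (H →L[ℂ] H))}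
    [hG : Fact (IsCommutantRelation l G)] [hl : Fact (IsVNRep l)]
    (hX : IsTotalFamily fun z : Intertwiner l G => z.toCLM) :
    IsVonNeumannAlgebra (AdjointableOperator B (Intertwiner l G)) :=
  ⟨H, inferInstance, inferInstance, inferInstance, endVN G,
    ⟨(StarAlgEquiv.ofBijective _ (lmul_bijective hX)).symm⟩⟩

end Intertwiner

end IntertwinerOperators

/-! ### Paschke dilations from Stinespring dilations -/

section Dilation

open scoped InnerProductSpace ComplexOrder
open Filter Topology

theorem StarAlgHom.exists_factor {A P Q : Type*} [CStarAlgebra A] [CStarAlgebra P]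
    [CStarAlgebra Q] {θ : P →⋆ₐ[ℂ] Q} (hθ : Function.Injective θ) (π : A →⋆ₐ[ℂ] Q)
    (h : ∀ a, ∃ p, θ p = π a) : ∃ ρ : A →⋆ₐ[ℂ] P, ∀ a, θ (ρ a) = π a := by
  choose ρ hρ using h
  exact ⟨
    { toFun := ρ
      map_one' := hθ <| by rw [hρ, map_one, map_one]
      map_mul' := fun a b => hθ <| by rw [hρ, map_mul, map_mul, hρ, hρ]
      map_zero' := hθ <| by rw [hρ, map_zero, map_zero]
      map_add' := fun a b => hθ <| by rw [hρ, map_add, map_add, hρ, hρ]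
      commutes' := fun c => hθ <| by rw [hρ, AlgHomClass.commutes, AlgHomClass.commutes]
      map_star' := fun a => hθ <| by rw [hρ, map_star, map_star, hρ] }, hρ⟩

theorem LinearMap.exists_factor {A P Q : Type*} [CStarAlgebra A] [CStarAlgebra P]
    [CStarAlgebra Q] {θ : P →⋆ₐ[ℂ] Q} (hθ : Function.Injective θ) (π : A →ₗ[ℂ] Q)
    (h : ∀ a, ∃ p, θ p = π a) : ∃ ρ : A →ₗ[ℂ] P, ∀ a, θ (ρ a) = π a := by
  choose ρ hρ using h
  exact ⟨
    { toFun := ρ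
      map_add' := fun a b => hθ <| by rw [hρ, map_add, map_add, hρ, hρ]
      map_smul' := fun c a => hθ <| by rw [hρ, map_smul, map_smul, hρ]; rfl }, hρ⟩

variable {A : Type*} {B : Type*} {P : Type*} [CStarAlgebra A] [PartialOrder A]
  [StarOrderedRing A] [CStarAlgebra B] [PartialOrder B] [StarOrderedRing B]
  [CStarAlgebra P] [PartialOrder P] [StarOrderedRing P]
  {K : Type*} [NormedAddCommGroup K] [InnerProductSpace ℂ K] [CompleteSpace K]
  {H : Type*} [NormedAddCommGroup H] [InnerProductSpace ℂ H] [CompleteSpace H]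

/-- The pairs of operators `c` in the commutant of `B` and `1 ⊗ c` on the Stinespring space. -/
def commutantGraph (l : B →⋆ₐ[ℂ] (K →L[ℂ] K)) (ε : A → K →L[ℂ] H) :
    Set ((K →L[ℂ] K) × (H →L[ℂ] H)) :=
  {p | (∀ b, Commute p.1 (l b)) ∧ ∀ a k, p.2 (ε a k) = ε a (p.1 k)}

namespace StarAlgHom

variable {Q : Type*} [CStarAlgebra Q] {E : Type*} [NormedAddCommGroup E]
  [InnerProductSpace ℂ E] [CompleteSpace E] (π : Q →⋆ₐ[ℂ] (E →L[ℂ] E)) (W : H →L[ℂ] E)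

/-- The map `p ↦ W⋆ π(p) W`. -/
noncomputable def compression : Q →ₗ[ℂ] (H →L[ℂ] H) where
  toFun p := ContinuousLinearMap.adjoint W ∘L π p ∘L W
  map_add' p q := by
    rw [map_add, ContinuousLinearMap.add_comp, ContinuousLinearMap.comp_add]
  map_smul' c p := by
    rw [map_smul, ContinuousLinearMap.smul_comp, ContinuousLinearMap.comp_smul]
    rfl

theorem compression_apply (p : Q) (z : H) :
    π.compression W p z = ContinuousLinearMap.adjoint W (π p (W z)) := rfl

theorem inner_compression_right (p : Q) (z z' : H) :
    ⟪z, π.compression W p z'⟫_ℂ = ⟪W z, π p (W z')⟫_ℂ := by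
  rw [compression_apply, ContinuousLinearMap.adjoint_inner_right]

theorem inner_compression_left (p : Q) (z z' : H) :
    ⟪π.compression W p z, z'⟫_ℂ = ⟪π p (W z), W z'⟫_ℂ := by
  rw [compression_apply, ContinuousLinearMap.adjoint_inner_left]

/-- The sum is ‖∑ᵢ π(aᵢ)Wzᵢ‖². -/
theorem sum_inner_compression_nonneg (n : ℕ) (a : Fin n → Q) (z : Fin n → H) :
    0 ≤ ∑ i, ∑ j, ⟪z i, π.compression W (star (a i) * a j) (z j)⟫_ℂ := by
  simp only [inner_compression_right, map_mul, map_star, mul_apply_eq_comp,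
    ContinuousLinearMap.star_eq_adjoint, ContinuousLinearMap.adjoint_inner_right]
  simp_rw [← inner_sum, ← sum_inner]
  rw [inner_self_eq_norm_sq_to_K]
  positivity

end StarAlgHom

namespace IsStinespring

variable {φ : A →CP B} {l : B →⋆ₐ[ℂ] (K →L[ℂ] K)} {ε : A → K →L[ℂ] H}

/-- This is (1 ⊗ c)⋆ = 1 ⊗ c⋆; it holds because c⋆ also commutes with every l(φ(α⋆a)). -/
theorem adjoint_commutantGraph (h : IsStinespring φ l ε)
    {p : (K →L[ℂ] K) × (H →L[ℂ] H)} (hp : p ∈ commutantGraph l ε) (a : A) (k : K) :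
    ContinuousLinearMap.adjoint p.2 (ε a k) = ε a (ContinuousLinearMap.adjoint p.1 k) := by
  refine h.total.eq_of_forall_inner fun α k' => ?_
  rw [ContinuousLinearMap.adjoint_inner_right, hp.2, h.inner_eq, h.inner_eq,
    ← ContinuousLinearMap.adjoint_inner_right]
  have hc : Commute (star p.1) (l (φ (star α * a))) := by
    have := (hp.1 (star (φ (star α * a)))).star_star
    rwa [map_star, star_star] at this
  exact congrArg (fun t => ⟪k', t⟫_ℂ) (DFunLike.congr_fun hc.eq k)

theorem isCommutantRelation (h : IsStinespring φ l ε) :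
    IsCommutantRelation l (commutantGraph l ε) where
  commute p hp := hp.1
  exists_mem c hc := by
    obtain ⟨T, hT⟩ := h.exists_commutant_rep hc
    exact ⟨T, hc, hT⟩
  star_mem p hp := by
    refine ⟨fun b => ?_, h.adjoint_commutantGraph hp⟩
    have := (hp.1 (star b)).star_star
    rwa [map_star, star_star] at this

theorem rep_commute (h : IsStinespring φ l ε) {π : A →⋆ₐ[ℂ] (H →L[ℂ] H)}
    (hπ : ∀ a α k, π a (ε α k) = ε (a * α) k) (a : A) {p : (K →L[ℂ] K) × (H →L[ℂ] H)}
    (hp : p ∈ commutantGraph l ε) (z : H) : π a (p.2 z) = p.2 (π a z) := by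
  have : π a ∘L p.2 = p.2 ∘L π a := h.total.clm_ext fun α k => by
    rw [ContinuousLinearMap.comp_apply, ContinuousLinearMap.comp_apply, hp.2, hπ, hπ, hp.2]
  exact DFunLike.congr_fun this z

/-- Compressions of weakly normal representations are normal. -/
theorem isNormalMap_of_inner_eq {l : B →⋆ₐ[ℂ] (K →L[ℂ] K)} (hl : IsVNRep l)
    {θ : P →⋆ₐ[ℂ] (H →L[ℂ] H)} (hθ : IsWeaklyNormal θ) (f : P →CP B) (V : K →L[ℂ] H)
    (hf : ∀ T k k', ⟪k, l (f T) k'⟫_ℂ = ⟪V k, θ T (V k')⟫_ℂ) : IsNormalMap f := by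
  refine isNormalMap_of_isWeaklyNormal_comp (fun a b => map_sub f a b)
    (fun a b hab => OrderHomClass.mono f hab) hl.injective ?_
  intro D hsa hne hdir s hs k
  refine (hθ D hsa hne hdir s hs (V k)).congr fun d => ?_
  rw [← inner_conj_symm, ← hf, inner_conj_symm]

/-- The Stinespring space of `φ` embeds into that of any dilation of `φ`. -/
theorem exists_compression (h : IsStinespring φ l ε) (hl : IsVNRep l)
    {P' : Type*} [CStarAlgebra P'] [PartialOrder P'] [StarOrderedRing P']
    (hP' : IsVonNeumannAlgebra P') (ρ' : A →⋆ₐ[ℂ] P') (f' : P' →CP B) (hf' : IsNormalMap f')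
    (hφ : ∀ a, f' (ρ' a) = φ a) :
    ∃ (σ₀ : P' →ₗ[ℂ] (H →L[ℂ] H)),
      (∀ (n : ℕ) (a : Fin n → P') (z : Fin n → H),
        0 ≤ ∑ i, ∑ j, ⟪z i, σ₀ (star (a i) * a j) (z j)⟫_ℂ) ∧
      IsWeaklyNormal σ₀ ∧
      ∀ p a α k k', ⟪ε a k, σ₀ p (ε α k')⟫_ℂ
        = ⟪k, l (f' (star (ρ' a) * p * ρ' α)) k'⟫_ℂ := by
  obtain ⟨H', _, _, _, ε', h'⟩ := exists_isStinespring f' l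
  obtain ⟨π', hπ'⟩ := h'.exists_rep
  have hnormal := h'.isWeaklyNormal_rep hl hf' hP' hπ'
  -- W preserves norms on generators' sums, since f'(ρ'(a)⋆ρ'(α)) = φ(a⋆α) makes the two Gram
  -- kernels equal.
  obtain ⟨W, -, hW⟩ := h.total.exists_extension (fun a => ε' (ρ' a)) zero_le_one
    fun n a k => by
      rw [one_mul]
      refine le_of_eq ((pow_left_inj₀ (norm_nonneg _) (norm_nonneg _) two_ne_zero).1 ?_)
      rw [h.norm_sq_sum, h'.norm_sq_sum]
      simp only [← map_star, ← map_mul, hφ]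
  refine ⟨π'.compression W, π'.sum_inner_compression_nonneg W, fun D hsa hne hdir s hs z => ?_,
    fun p a α k k' => ?_⟩
  · exact (hnormal D hsa hne hdir s hs (W z)).congr fun d =>
      (π'.inner_compression_left W _ _ _).symm
  · rw [π'.inner_compression_right, hW, hW, hπ', h'.inner_eq, mul_assoc]

/-- The mediating map out of another dilation. -/
theorem exists_mediating (h : IsStinespring φ l ε) (hl : IsVNRep l)
    {θ : P →⋆ₐ[ℂ] (H →L[ℂ] H)} (hθ : Function.Injective θ)
    (hθ' : ∀ S : H →L[ℂ] H, (∀ p ∈ commutantGraph l ε, ∀ z, S (p.2 z) = p.2 (S z)) →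
      ∃ T, θ T = S)
    {P' : Type*} [CStarAlgebra P'] [PartialOrder P'] [StarOrderedRing P']
    (hP' : IsVonNeumannAlgebra P') (ρ' : A →⋆ₐ[ℂ] P') (f' : P' →CP B) (hf' : IsNormalMap f')
    (hφ : ∀ a, f' (ρ' a) = φ a) :
    ∃ σ : P' →CP P, IsNormalMap σ ∧ ∀ p a α k k',
      ⟪ε a k, θ (σ p) (ε α k')⟫_ℂ = ⟪k, l (f' (star (ρ' a) * p * ρ' α)) k'⟫_ℂ := by
  obtain ⟨σ₀, hpos₀, hnormal, hcoef⟩ := h.exists_compression hl hP' ρ' f' hf' hφ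
  -- The matrix coefficients of σ₀ p lie in l(B) and so commute with c; hence σ₀ p commutes with 1 ⊗
  -- c and comes from P.
  have hrange : ∀ p, ∃ T, θ T = σ₀ p := fun p => hθ' _ fun q hq => by
    have : σ₀ p ∘L q.2 = q.2 ∘L σ₀ p := h.total.clm_ext fun α k' =>
      h.total.eq_of_forall_inner fun a k => by
        rw [ContinuousLinearMap.comp_apply, ContinuousLinearMap.comp_apply, hq.2, hcoef,
          ← ContinuousLinearMap.adjoint_inner_left q.2, h.adjoint_commutantGraph hq, hcoef,
          ContinuousLinearMap.adjoint_inner_left]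
        exact congrArg (fun t => ⟪k, t⟫_ℂ) (DFunLike.congr_fun (hq.1 _).eq k').symm
    exact fun z => DFunLike.congr_fun this z
  obtain ⟨σ₁, hσ₁⟩ := LinearMap.exists_factor hθ σ₀ hrange
  have hpos : ∀ (n : ℕ) (a : Fin n → P') (b : Fin n → P),
      0 ≤ ∑ i, ∑ j, star (b i) * σ₁ (star (a i) * a j) * b j := by
    intro n a b
    refine nonneg_of_forall_inner hθ fun z => ?_
    have : ⟪θ (∑ i, ∑ j, star (b i) * σ₁ (star (a i) * a j) * b j) z, z⟫_ℂ
        = star (∑ i, ∑ j, ⟪θ (b i) z, σ₀ (star (a i) * a j) (θ (b j) z)⟫_ℂ) := by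
      rw [RCLike.star_def, ← inner_conj_symm]
      simp only [map_sum, map_mul, hσ₁, sum_apply, inner_sum, mul_apply_eq_comp, map_star,
        ContinuousLinearMap.star_eq_adjoint, ContinuousLinearMap.adjoint_inner_right]
    rw [this]
    exact star_nonneg_iff.2 (hpos₀ n a fun i => θ (b i) z)
  refine ⟨CompletelyPositiveMap.ofSumNonneg σ₁ hpos, ?_, fun p a α k k' => ?_⟩
  · refine isNormalMap_of_isWeaklyNormal_comp
      (f := CompletelyPositiveMap.ofSumNonneg σ₁ hpos) (fun a b => map_sub _ a b)
      (fun a b hab => OrderHomClass.mono _ hab) hθ ?_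
    have : (fun p => θ (CompletelyPositiveMap.ofSumNonneg σ₁ hpos p)) = σ₀ :=
      funext fun p => by rw [CompletelyPositiveMap.ofSumNonneg_apply, hσ₁]
    rw [this]
    exact hnormal
  · rw [CompletelyPositiveMap.ofSumNonneg_apply, hσ₁, hcoef]

/-- The commutant of the commutant of `B` on the Stinespring space is a Paschke dilation. -/
theorem isPaschkeDilation {A : Type u} {B : Type v} {P : Type x} [CStarAlgebra A]
    [PartialOrder A] [StarOrderedRing A] [CStarAlgebra B] [PartialOrder B] [StarOrderedRing B]
    [CStarAlgebra P] [PartialOrder P] [StarOrderedRing P] {φ : A →CP B}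
    {l : B →⋆ₐ[ℂ] (K →L[ℂ] K)} {ε : A → K →L[ℂ] H}
    (h : IsStinespring φ l ε) (hl : IsVNRep l) (hP : IsVonNeumannAlgebra P)
    {θ : P →⋆ₐ[ℂ] (H →L[ℂ] H)} (hθ : IsVNRep θ)
    (hθ' : ∀ S : H →L[ℂ] H, (∀ p ∈ commutantGraph l ε, ∀ z, S (p.2 z) = p.2 (S z)) →
      ∃ T, θ T = S)
    {ρ : A →⋆ₐ[ℂ] P} (hρ : ∀ a α k, θ (ρ a) (ε α k) = ε (a * α) k) (hρn : IsNormalMap ρ)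
    {f : P →CP B} (hf : ∀ T k k', ⟪k, l (f T) k'⟫_ℂ = ⟪ε 1 k, θ T (ε 1 k')⟫_ℂ)
    (hfn : IsNormalMap f) : IsPaschkeDilation.{u, v, w, x} φ ρ f := by
  have hfρ : ∀ a, f (ρ a) = φ a := fun a => hl.injective <|
    ContinuousLinearMap.ext fun k' => ext_inner_left ℂ fun k => by
      rw [hf, hρ, h.inner_eq, star_one, one_mul, mul_one]
  refine ⟨hP, hρn, hfn, hfρ, ?_⟩
  intro P' _ _ _ hP' ρ' f' _ hf' hφ
  obtain ⟨σ, hσn, hσ⟩ := h.exists_mediating hl hθ.injective hθ' hP' ρ' f' hf' hφ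
  have hcoef : ∀ (T : P) a α k k', ⟪ε a k, θ T (ε α k')⟫_ℂ
      = ⟪k, l (f (star (ρ a) * T * ρ α)) k'⟫_ℂ := fun T a α k k' => by
    rw [hf, map_mul, map_mul, map_star, mul_apply_eq_comp, mul_apply_eq_comp,
      ContinuousLinearMap.star_eq_adjoint, ContinuousLinearMap.adjoint_inner_right, hρ, hρ,
      mul_one, mul_one]
  have hext : ∀ S T : P, (∀ a α k k', ⟪ε a k, θ S (ε α k')⟫_ℂ = ⟪ε a k, θ T (ε α k')⟫_ℂ) →
      S = T := fun S T hST => hθ.injective <| h.total.clm_ext fun α k' =>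
    h.total.eq_of_forall_inner fun a k => hST a α k k'
  have hσρ : ∀ a, σ (ρ' a) = ρ a := fun a => hext _ _ fun b α k k' => by
    rw [hσ, hcoef, ← map_star, ← map_mul, ← map_mul, hφ, ← map_star, ← map_mul, ← map_mul, hfρ]
  have hfσ : ∀ p, f (σ p) = f' p := fun p => hl.injective <|
    ContinuousLinearMap.ext fun k' => ext_inner_left ℂ fun k => by
      rw [hf, hσ, map_one, star_one, one_mul, mul_one]
  refine ⟨σ, ⟨hσn, hσρ, hfσ⟩, ?_⟩
  rintro τ ⟨-, hτρ, hfτ⟩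
  -- Since τ ∘ ρ' = ρ is a unital homomorphism, the range of ρ' lies in the multiplicative domain of
  -- τ. Consequently ρ(a)⋆τ(p)ρ(α) = τ(ρ'(a)⋆pρ'(α)), and applying f determines every coefficient of
  -- τ(p).
  have h1 : τ 1 = 1 := by rw [← map_one ρ', hτρ, map_one]
  have hleft : ∀ a p, τ (star (ρ' a) * p) = star (ρ a) * τ p := fun a p => by
    rw [τ.map_star_mul_of_map_star_mul_self hθ.injective h1, hτρ]
    rw [← map_star, ← map_mul, hτρ, map_mul, map_star, hτρ]
  have hright : ∀ a p, τ (p * ρ' a) = τ p * ρ a := fun a p => by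
    have := congrArg star (hleft a (star p))
    rwa [← τ.map_star', star_mul, star_star, star_star, star_mul, star_star, τ.map_star',
      star_star] at this
  refine DFunLike.ext _ _ fun p => hext _ _ fun a α k k' => ?_
  rw [hσ, hcoef, ← hleft, ← hright, hfτ]

end IsStinespring

end Dilation

/-! ### The module `A ⊗_φ B` -/

section Tensor

open scoped InnerProductSpace ComplexOrder

variable {A : Type*} {B : Type*} [CStarAlgebra A] [PartialOrder A]
  [StarOrderedRing A] [CStarAlgebra B] [PartialOrder B] [StarOrderedRing B]
  {K : Type*} [NormedAddCommGroup K] [InnerProductSpace ℂ K] [CompleteSpace K]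
  {H : Type*} [NormedAddCommGroup H] [InnerProductSpace ℂ H]
  {φ : A →CP B} {l : B →⋆ₐ[ℂ] (K →L[ℂ] K)} {ε : A → K →L[ℂ] H}

namespace IsStinespring

/-- The canonical map `(a, b) ↦ a ⊗ b`. -/
noncomputable def tensor (h : IsStinespring φ l ε) :
    A →ₗ[ℂ] B →ₗ[ℂ] Intertwiner l (commutantGraph l ε) :=
  LinearMap.mk₂ ℂ (fun a b => op b • Intertwiner.mk (ε a) fun p hp k => (hp.2 a k).symm)
    (fun a α b => Intertwiner.toCLM_injective <| by
      rw [_root_.map_add, Intertwiner.toCLM_op_smul, Intertwiner.toCLM_op_smul,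
        Intertwiner.toCLM_op_smul, Intertwiner.toCLM_mk, Intertwiner.toCLM_mk,
        Intertwiner.toCLM_mk, h.map_add, ContinuousLinearMap.add_comp])
    (fun c a b => Intertwiner.toCLM_injective <| by
      rw [Intertwiner.toCLM.map_smul c, Intertwiner.toCLM_op_smul, Intertwiner.toCLM_op_smul,
        Intertwiner.toCLM_mk, Intertwiner.toCLM_mk, h.map_smul, ContinuousLinearMap.smul_comp])
    (fun a b β => by rw [op_add, add_smul])
    (fun c a b => by rw [op_smul, smul_assoc])

theorem toCLM_tensor (h : IsStinespring φ l ε) (a : A) (b : B) (k : K) :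
    (h.tensor a b).toCLM k = ε a (l b k) := rfl

theorem toCLM_tensor_one (h : IsStinespring φ l ε) (a : A) : (h.tensor a 1).toCLM = ε a := by
  ext k
  rw [toCLM_tensor, map_one, one_apply_eq_self]

theorem op_smul_tensor (h : IsStinespring φ l ε) (a : A) (b c : B) :
    op c • h.tensor a b = h.tensor a (b * c) :=
  Intertwiner.toCLM_injective <| ContinuousLinearMap.ext fun k => by
    rw [Intertwiner.toCLM_op_smul_apply, toCLM_tensor, toCLM_tensor, map_mul, mul_apply_eq_comp]

theorem op_smul_tensor_one (h : IsStinespring φ l ε) (a : A) (b : B) :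
    op b • h.tensor a 1 = h.tensor a b := by rw [op_smul_tensor, one_mul]

/-- The elements a ⊗ 1 suffice as generators because a ⊗ b = (a ⊗ 1)b; estimates on B-combinations
of them are exactly estimates on sums of simple tensors. -/
theorem total_tensor_one (h : IsStinespring φ l ε) :
    IsTotalFamily fun a => (h.tensor a 1).toCLM :=
  h.total.mono id fun a k => by rw [h.toCLM_tensor_one]; rfl

theorem total_toCLM (h : IsStinespring φ l ε) :
    IsTotalFamily fun z : Intertwiner l (commutantGraph l ε) => z.toCLM :=
  h.total_tensor_one.mono (fun a => h.tensor a 1) fun _ _ => rfl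

theorem total_span (h : IsStinespring φ l ε) :
    IsTotalFamily fun z : Submodule.span Bᵐᵒᵖ (Set.range fun p : A × B => h.tensor p.1 p.2) =>
      (z : Intertwiner l (commutantGraph l ε)).toCLM :=
  h.total_tensor_one.mono
    (fun a => ⟨h.tensor a 1, Submodule.subset_span ⟨(a, 1), rfl⟩⟩) fun _ _ => rfl

variable [CompleteSpace H] [hl : Fact (IsVNRep l)]
  [hG : Fact (IsCommutantRelation l (commutantGraph l ε))]

theorem inner_tensor (h : IsStinespring φ l ε) (a α : A) (b β : B) :
    inner B (h.tensor a b) (h.tensor α β) = star b * φ (star a * α) * β :=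
  hl.out.injective <| ContinuousLinearMap.ext fun k' => ext_inner_left ℂ fun k => by
    rw [← Intertwiner.inner_toCLM, toCLM_tensor, toCLM_tensor, h.inner_eq, map_mul l, map_mul l,
      map_star l, mul_apply_eq_comp, mul_apply_eq_comp, ContinuousLinearMap.star_eq_adjoint,
      ContinuousLinearMap.adjoint_inner_right]

theorem norm_sum_tensor_sq (h : IsStinespring φ l ε) {n : ℕ} (a : Fin n → A) (b : Fin n → B) :
    ‖∑ i, h.tensor (a i) (b i)‖ ^ 2
      = ‖∑ i, ∑ j, star (b i) * φ (star (a i) * a j) * b j‖ := by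
  rw [PreHilbertModule.norm_sq (B := B)]
  simp only [PreHilbertModule.inner_sum_left, PreHilbertModule.inner_sum_right, inner_tensor]
  rw [Finset.sum_comm]

theorem isCompatible_tensor (h : IsStinespring φ l ε) : IsCompatible φ h.tensor :=
  ⟨⟨1, one_pos, fun n a b => by rw [norm_sum_tensor_sq, one_mul]⟩, h.op_smul_tensor⟩

/-- The universal property of `A ⊗_φ B`. -/
theorem existsUnique_tensor_lift (h : IsStinespring φ l ε) {Y : Type*} [NormedAddCommGroup Y]
    [NormedSpace ℂ Y] [Module Bᵐᵒᵖ Y] [IsScalarTower ℂ Bᵐᵒᵖ Y] [PreHilbertModule B Y]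
    (hY : IsSelfDual B Y) (β : A →ₗ[ℂ] B →ₗ[ℂ] Y) (hβ : IsCompatible φ β) :
    ∃! T : Intertwiner l (commutantGraph l ε) →L[Bᵐᵒᵖ] Y,
      ∀ (a : A) (b : B), T (h.tensor a b) = β a b := by
  obtain ⟨⟨r, hr, hβr⟩, hβ⟩ := hβ
  have hβ1 : ∀ a b, op b • β a 1 = β a b := fun a b => by rw [hβ, one_mul]
  obtain ⟨T, hT, hT'⟩ := Intertwiner.existsUnique_lift h.total_tensor_one hY (fun a => β a 1)
    (Real.sqrt_nonneg r) fun n a b => by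
      simp only [hβ1, h.op_smul_tensor_one]
      refine (pow_le_pow_iff_left₀ (norm_nonneg _) (by positivity) two_ne_zero).1 ?_
      rw [mul_pow, Real.sq_sqrt hr.le, h.norm_sum_tensor_sq]
      exact hβr n a b
  refine ⟨T, fun a b => ?_, fun S hS => hT' S fun a => hS a 1⟩
  rw [← h.op_smul_tensor_one, _root_.map_smul, hT, hβ1]

theorem isCompatible_mul_left (h : IsStinespring φ l ε) (a₀ : A) :
    IsCompatible φ (h.tensor ∘ₗ LinearMap.mulLeft ℂ a₀) := by
  -- The bound ‖a₀‖² comes from the vector estimate applied to aᵢ ⊗ l(bᵢ)k; the added 1 keeps the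
  -- constant positive when a₀ = 0.
  refine ⟨⟨‖a₀‖ ^ 2 + 1, by positivity, fun n a b => ?_⟩, fun a => h.op_smul_tensor (a₀ * a)⟩
  have h1 : ‖∑ i, h.tensor (a₀ * a i) (b i)‖ ≤ ‖a₀‖ * ‖∑ i, h.tensor (a i) (b i)‖ := by
    rw [← Intertwiner.norm_toCLM]
    refine ContinuousLinearMap.opNorm_le_bound _ (by positivity) fun k => ?_
    have h2 := h.norm_sum_mul_le a₀ a fun i => l (b i) k
    simp only [← h.toCLM_tensor] at h2
    rw [map_sum, sum_apply]
    refine h2.trans ?_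
    rw [← sum_apply, ← map_sum, mul_assoc, ← Intertwiner.norm_toCLM]
    gcongr
    exact ContinuousLinearMap.le_opNorm _ _
  rw [← h.norm_sum_tensor_sq]
  calc _ ≤ (‖a₀‖ * ‖∑ i, h.tensor (a i) (b i)‖) ^ 2 := by
        gcongr
        exact h1
    _ ≤ _ := by
        rw [mul_pow]
        gcongr
        linarith

end IsStinespring

/-- Vectors of a Hilbert module define completely positive maps on its adjointable operators. -/
theorem AdjointableOperator.exists_vector_map {X : Type*} [NormedAddCommGroup X]
    [NormedSpace ℂ X] [CompleteSpace X] [Module Bᵐᵒᵖ X] [IsScalarTower ℂ Bᵐᵒᵖ X]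
    [PreHilbertModule B X] (z : X) :
    ∃ f : AdjointableOperator B X →CP B, ∀ T, f T = inner B z (T z) := by
  refine ⟨CompletelyPositiveMap.ofSumNonneg
    { toFun := fun T => inner B z (T z)
      map_add' := fun S T => PreHilbertModule.inner_add_right z (S z) (T z)
      map_smul' := fun c T => PreHilbertModule.inner_smul_right c z (T z) }
    fun n a b => ?_, fun T => rfl⟩
  -- The sum required for complete positivity is the inner square of ∑ᵢ (aᵢz)bᵢ.
  refine (PreHilbertModule.inner_self_nonneg (B := B) (∑ i, op (b i) • a i z)).trans_eq ?_
  rw [PreHilbertModule.inner_sum_left]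
  refine Finset.sum_congr rfl fun i _ => ?_
  rw [PreHilbertModule.inner_sum_right]
  refine Finset.sum_congr rfl fun j _ => ?_
  rw [PreHilbertModule.inner_op_smul_left, PreHilbertModule.inner_op_smul_right,
    AdjointableOperator.inner_adj_right, mul_assoc]
  rfl

namespace IsStinespring

variable [CompleteSpace H] [hl : Fact (IsVNRep l)]
  [hG : Fact (IsCommutantRelation l (commutantGraph l ε))]

/-- Left multiplication is a normal representation of `A` on `A ⊗_φ B`. -/
theorem exists_left_rep (h : IsStinespring φ l ε) (hA : IsVonNeumannAlgebra A)
    (hφ : IsNormalMap φ)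
    {θ : AdjointableOperator B (Intertwiner l (commutantGraph l ε)) →⋆ₐ[ℂ] (H →L[ℂ] H)}
    (hθ : IsVNRep θ) (hθz : ∀ T z k, θ T (z.toCLM k) = (T z).toCLM k)
    (hθ' : ∀ S : H →L[ℂ] H, (∀ p ∈ commutantGraph l ε, ∀ z, S (p.2 z) = p.2 (S z)) →
      ∃ T, θ T = S) :
    ∃ ρ : A →⋆ₐ[ℂ] AdjointableOperator B (Intertwiner l (commutantGraph l ε)),
      (∀ a α k, θ (ρ a) (ε α k) = ε (a * α) k) ∧ (∀ a₀ a b,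
        ρ a₀ (h.tensor a b) = h.tensor (a₀ * a) b) ∧ IsNormalMap ρ := by
  obtain ⟨π, hπ⟩ := h.exists_rep
  obtain ⟨ρ, hρ⟩ := StarAlgHom.exists_factor hθ.injective π fun a =>
    hθ' _ fun p hp => h.rep_commute hπ a hp
  refine ⟨ρ, fun a α k => by rw [hρ, hπ], fun a₀ a b => Intertwiner.toCLM_injective <|
    ContinuousLinearMap.ext fun k => ?_, ?_⟩
  · rw [← hθz, hρ, toCLM_tensor, hπ, toCLM_tensor]
  · refine isNormalMap_of_isWeaklyNormal_comp (fun a b => map_sub ρ a b)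
      (fun a b hab => OrderHomClass.mono ρ hab) hθ.injective ?_
    simp only [hρ]
    exact h.isWeaklyNormal_rep hl.out hφ hA hπ

end IsStinespring

end Tensor

theorem mainTheorem1 {A : Type u} {B : Type v}
    [CStarAlgebra A] [PartialOrder A] [StarOrderedRing A]
    [CStarAlgebra B] [PartialOrder B] [StarOrderedRing B]
    (hA : IsVonNeumannAlgebra A) (hB : IsVonNeumannAlgebra B)
    (φ : A →CP B) (hφ : IsNormalMap φ) :
    -- the self-dual Hilbert `B`-module `X = A ⊗_φ B` and the map `t : (a, b) ↦ a ⊗ b`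
    (∃ (X : Type (max u v)) (_ : NormedAddCommGroup X) (_ : NormedSpace ℂ X)
      (_ : CompleteSpace X) (_ : Module Bᵐᵒᵖ X) (_ : IsScalarTower ℂ Bᵐᵒᵖ X)
      (_ : PreHilbertModule B X) (t : A →ₗ[ℂ] B →ₗ[ℂ] X),
      IsSelfDual B X ∧ IsCompatible φ t ∧
      (∀ (a α : A) (b β : B),
        inner B (t a b) (t α β) = star b * φ (star a * α) * β) ∧
      -- `X` is the dual of the pre-Hilbert module spanned by the `a ⊗ b`
      (∀ τ : Submodule.span Bᵐᵒᵖ (Set.range fun p : A × B => t p.1 p.2) →L[Bᵐᵒᵖ] B,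
        ∃! z : X, ∀ z', τ z' = inner B z (z' : X)) ∧
      -- universal property of `⊗`
      (∀ (Y : Type y) [NormedAddCommGroup Y] [NormedSpace ℂ Y] [CompleteSpace Y]
        [Module Bᵐᵒᵖ Y] [IsScalarTower ℂ Bᵐᵒᵖ Y] [PreHilbertModule B Y],
        IsSelfDual B Y → ∀ β : A →ₗ[ℂ] B →ₗ[ℂ] Y, IsCompatible φ β →
          ∃! T : X →L[Bᵐᵒᵖ] Y, ∀ (a : A) (b : B), T (t a b) = β a b) ∧
      -- left multiplication
      (∀ a₀ : A, ∃! T : X →L[Bᵐᵒᵖ] X, ∀ (a : A) (b : B), T (t a b) = t (a₀ * a) b) ∧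
      ∃ (ρ : A →⋆ₐ[ℂ] AdjointableOperator B X) (f : AdjointableOperator B X →CP B),
        (∀ (a₀ a : A) (b : B), ρ a₀ (t a b) = t (a₀ * a) b) ∧ IsNormalMap ρ ∧
        (∀ T : AdjointableOperator B X, f T = inner B (t 1 1) (T (t 1 1))) ∧ IsNormalMap f ∧
        IsPaschkeDilation.{u, v, w, max u v} φ ρ f) ∧
    -- every NCP-map has a Paschke dilation
    ∃ (P : Type (max u v)) (_ : CStarAlgebra P) (_ : PartialOrder P) (_ : StarOrderedRing P)
      (ρ : A →⋆ₐ[ℂ] P) (f : P →CP B), IsPaschkeDilation.{u, v, w, max u v} φ ρ f := by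
  obtain ⟨K, _, _, _, S, ⟨e⟩⟩ := hB
  have hl := isVNRep_of_equiv S e
  set l : B →⋆ₐ[ℂ] (K →L[ℂ] K) := S.toStarSubalgebra.subtype.comp
    (e : B →⋆ₐ[ℂ] S.toStarSubalgebra) with hldef
  clear_value l
  obtain ⟨H, _, _, _, ε, h⟩ := exists_isStinespring φ l
  have : Fact (IsVNRep l) := ⟨hl⟩
  have : Fact (IsCommutantRelation l (commutantGraph l ε)) := ⟨h.isCommutantRelation⟩
  have hP := Intertwiner.isVonNeumannAlgebra_adjointable h.total_toCLM
  obtain ⟨θ, hθ, hθz, hθ'⟩ := Intertwiner.exists_rep_adjointable h.total_toCLM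
  obtain ⟨ρ, hθρ, hρ, hρn⟩ := h.exists_left_rep hA hφ hθ hθz hθ'
  obtain ⟨f, hf⟩ := AdjointableOperator.exists_vector_map (B := B) (h.tensor 1 1)
  -- As an operator K → H, the vector 1 ⊗ 1 is ε 1, so f is compression by ε 1 in the representation
  -- on H; this gives both its normality and the hypothesis of `isPaschkeDilation`.
  have hfθ : ∀ T k k', inner ℂ k (l (f T) k') = inner ℂ (ε 1 k) (θ T (ε 1 k')) := fun T k k' => by
    rw [hf, ← Intertwiner.inner_toCLM, ← hθz, h.toCLM_tensor_one]
  have hfn : IsNormalMap f := IsStinespring.isNormalMap_of_inner_eq hl hθ.isWeaklyNormal f _ hfθ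
  have hdil : IsPaschkeDilation.{u, v, w, max u v} φ ρ f :=
    h.isPaschkeDilation hl hP hθ hθ' hθρ hρn hfθ hfn
  have hsd := Intertwiner.isSelfDual h.total_toCLM
  refine ⟨⟨Intertwiner l (commutantGraph l ε), inferInstance, inferInstance, inferInstance,
    inferInstance, inferInstance, inferInstance, h.tensor, hsd, h.isCompatible_tensor,
    h.inner_tensor, fun τ => Intertwiner.existsUnique_inner_eq _ h.total_span τ, ?_,
    fun a₀ => h.existsUnique_tensor_lift hsd _ (h.isCompatible_mul_left a₀), ρ, f, hρ, hρn, hf,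
    hfn, hdil⟩, AdjointableOperator B (Intertwiner l (commutantGraph l ε)), inferInstance,
    inferInstance, inferInstance, ρ, f, hdil⟩
  intro Y _ _ _ _ _ _ hY β hβ
  exact h.existsUnique_tensor_lift hY β hβ
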